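/- Let $A\in\mathbb R^{n\times n}$, $B\in\mathbb R^{n\times m}$, and let $\mathcal A\in\{0,*\}^{n\times n}$, $\mathcal B\in\{0,*\}^{n\times m}$ be pattern matrices. For a pattern matrix $\mathcal M\in\{0,*\}^{n_1\times n_2}$ let $[\mathcal M]$ be the set of matrices $M\in\mathbb R^{n_1\times n_2}$ with $M_{ij}=0$ whenever $\mathcal M_{ij}=0$, and let $\operatorname{grank}\mathcal M=\max\{\operatorname{rank} M: M\in[\mathcal M]\}$. Let $\sigma(A)\subset\mathbb C$ be the set of complex eigenvalues of $A$. A pair $(A',B')$ is controllable if for all $x_0,x_1\in\mathbb R^n$ some input $u$ steers $\dot x=A'x+B'u$ from $x_0$ to $x_1$ in some finite time. The matroid formed by the columns of a $p\times q$ matrix $W$ has ground set $\{1,\dots,q\}$ and independent sets $I$ with $\operatorname{rank}W(:,I)=|I|$; if $W$ is a pattern matrix, $\operatorname{rank}$ is replaced by $\operatorname{grank}$. The cardinality of the intersection of two matroids on the same ground set is the largest size of a common independent set. $\bar I_k$ denotes the $k\times k$ pattern matrix with $*$ on the diagonal and $0$ elsewhere. The auxiliary connection graph $\mathcal G$ is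 the directed graph with vertices $z_1,\dots,z_{n+m}$, $x_1,\dots,x_n$, $u_1,\dots,u_m$ and the following edges, where $$G_{zx}(\lambda)=\begin{bmatrix}(\lambda I-A)^{-1}\\ 0_{m\times n}\end{bmatrix},\qquad G_{zu}(\lambda)=\begin{bmatrix}(\lambda I-A)^{-1}B\\ I_m\end{bmatrix}$$ are matrices of rational functions of $\lambda$: an edge from $x_j$ to $z_i$ if $[G_{zx}(\lambda)]_{ij}$ is not the zero function; an edge from $u_j$ to $z_i$ if $[G_{zu}(\lambda)]_{ij}$ is not the zero function; an edge from $z_i$ to $x_j$ if $[\mathcal A,\mathcal B]_{ji}=*$. A vertex is input-reachable if a directed path leads to it from some $u_j$; an edge from some $x_j$ to some $z_i$ is input-reachable if $x_j$ or $z_i$ is. The following three statements are equivalent. 1. There are $\Delta A\in[\mathcal A]$ and $\Delta B\in[\mathcal B]$ such that $(A+\Delta A,B+\Delta B)$ is controllable. 2. (a) For each $\lambda\in\sigma(A)$, $$\max_{\Delta A\in[\mathcal A],\,\Delta B\in[\mathcal B]}\operatorname{rank}[\lambda I-A-\Delta A,\;B+\Delta B]=n;$$ (b) every edge of $\mathcal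 G$ from a vertex $x_j$ to a vertex $z_i$ is input-reachable. 3. (a) For each $\lambda\in\sigma(A)$, the intersection of the matroid formed by the columns of $[\,I_n,\ \lambda I-A,\ B\,]$ and the matroid formed by the columns of $[\,[\mathcal A,\mathcal B]^{\intercal},\ \bar I_{n+m}\,]$ has cardinality $n$; (b) every vertex $z_1,\dots,z_{n+m}$ of $\mathcal G$ is input-reachable. -/

import Mathlib

open scoped Matrix

noncomputable section

namespace ZeroNormControl

/-! ### Controllability of `ẋ(t) = A x(t) + B u(t)` -/

/-- The input `u` steers the system `ẋ = A x + B u` from the state `x₀` at time `0` to the state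
`x₁` at time `T`: `u` is integrable on `[0, T]` and the (absolutely continuous) trajectory
`x` started at `x₀` under this input ends at `x₁`. -/
def Steers {n m : ℕ} (A : Matrix (Fin n) (Fin n) ℝ) (B : Matrix (Fin n) (Fin m) ℝ)
    (u : ℝ → Fin m → ℝ) (x₀ x₁ : Fin n → ℝ) (T : ℝ) : Prop :=
  IntervalIntegrable u MeasureTheory.volume 0 T ∧
    ∃ x : ℝ → Fin n → ℝ, ContinuousOn x (Set.Icc 0 T) ∧
      (∀ t ∈ Set.Icc 0 T, x t = x₀ + ∫ s in (0 : ℝ)..t, (A *ᵥ x s + B *ᵥ u s)) ∧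
      x T = x₁

/-- `(A, B)` is controllable: the state can be steered from any point to any point in some
finite time. -/
def Controllable {n m : ℕ} (A : Matrix (Fin n) (Fin n) ℝ) (B : Matrix (Fin n) (Fin m) ℝ) :
    Prop :=
  ∀ x₀ x₁ : Fin n → ℝ, ∃ T : ℝ, 0 < T ∧ ∃ u : ℝ → Fin m → ℝ, Steers A B u x₀ x₁ T

/-! ### Pattern matrices -/

/-- The two possible entries of a pattern matrix: a fixed zero and a free entry `*`. -/
inductive Entry : Type
  | zero
  | star

/-- Pattern matrices, with entries from `{0, *}`. -/
abbrev Pattern (ι κ : Type) : Type := Matrix ι κ Entry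

/-- The set `[P]` of real matrices that vanish wherever the pattern `P` has the entry `0`. -/
def Pattern.realizations {ι κ : Type} (P : Pattern ι κ) : Set (Matrix ι κ ℝ) :=
  {M | ∀ i j, P i j = Entry.zero → M i j = 0}

/-- The square pattern with `*` on the diagonal and `0` elsewhere. -/
def Pattern.diag (ι : Type) [DecidableEq ι] : Pattern ι ι :=
  Matrix.of fun i j => if i = j then Entry.star else Entry.zero

/-- The generic rank of a pattern: the largest rank of a realization. (The set of these ranks
is nonempty and bounded by the number of columns.) -/
def Pattern.grank {ι κ : Type} [Fintype κ] (P : Pattern ι κ) : ℕ :=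
  sSup {r | ∃ M ∈ P.realizations, M.rank = r}

/-- The perturbed system `[A + ΔA, B + ΔB]`, with `ΔA ∈ [𝒜]` and `ΔB ∈ [ℬ]`, is structurally
controllable. -/
def StructurallyControllable {n m : ℕ} (A : Matrix (Fin n) (Fin n) ℝ)
    (B : Matrix (Fin n) (Fin m) ℝ) (𝒜 : Pattern (Fin n) (Fin n)) (ℬ : Pattern (Fin n) (Fin m)) :
    Prop :=
  ∃ ΔA ∈ 𝒜.realizations, ∃ ΔB ∈ ℬ.realizations, Controllable (A + ΔA) (B + ΔB)

/-! ### Matroids formed by the columns of a matrix or of a pattern -/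

/-- The columns of `W` indexed by `I` are independent: `rank W(:, I) = |I|`. -/
def ColsIndep {K ι κ : Type} [Field K] (W : Matrix ι κ K) (I : Finset κ) : Prop :=
  (W.submatrix id (Subtype.val : I → κ)).rank = I.card

/-- The columns of the pattern `P` indexed by `I` are generically independent:
`grank P(:, I) = |I|`. -/
def Pattern.ColsIndep {ι κ : Type} (P : Pattern ι κ) (I : Finset κ) : Prop :=
  Pattern.grank (P.submatrix id (Subtype.val : I → κ)) = I.card

theorem colsIndep_iff {K ι κ : Type} [Field K] (W : Matrix ι κ K) (I : Finset κ) :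
    ZeroNormControl.ColsIndep W I ↔ LinearIndepOn K W.col (I : Set κ) := by
  unfold ZeroNormControl.ColsIndep
  rw [Matrix.rank_eq_finrank_span_cols, LinearIndepOn]
  have h := linearIndependent_iff_card_eq_finrank_span (R := K)
    (b := (W.submatrix id (Subtype.val : I → κ)).col)
  rw [Fintype.card_coe] at h
  exact eq_comm.trans h.symm

theorem colsIndep_empty {K ι κ : Type} [Field K] (W : Matrix ι κ K) :
    ZeroNormControl.ColsIndep W ∅ := by
  rw [colsIndep_iff]; simp

theorem ColsIndep.subset {K ι κ : Type} [Field K] {W : Matrix ι κ K} {I J : Finset κ}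
    (hJ : ZeroNormControl.ColsIndep W J) (h : I ⊆ J) : ZeroNormControl.ColsIndep W I := by
  rw [colsIndep_iff] at *
  exact hJ.mono (by exact_mod_cast h)

theorem ColsIndep.augment {K ι κ : Type} [Field K] [DecidableEq κ] {W : Matrix ι κ K}
    {I J : Finset κ} (hI : ZeroNormControl.ColsIndep W I) (hJ : ZeroNormControl.ColsIndep W J)
    (h : I.card < J.card) :
    ∃ e ∈ J, e ∉ I ∧ ZeroNormControl.ColsIndep W (insert e I) := by
  rw [colsIndep_iff] at hI hJ
  by_contra! hc
  have hspan : ∀ e ∈ J, W.col e ∈ Submodule.span K (W.col '' (I : Set κ)) := by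
    intro e he
    by_cases heI : e ∈ I
    · exact Submodule.subset_span ⟨e, heI, rfl⟩
    · by_contra hns
      refine hc e he heI ?_
      rw [colsIndep_iff, Finset.coe_insert]
      exact hI.insert hns
  have hle : Submodule.span K (W.col '' (J : Set κ)) ≤ Submodule.span K (W.col '' (I : Set κ)) := by
    rw [Submodule.span_le]
    rintro _ ⟨e, he, rfl⟩
    exact hspan e he
  have hfin : FiniteDimensional K (Submodule.span K (W.col '' (I : Set κ))) :=
    FiniteDimensional.span_of_finite K (I.finite_toSet.image _)
  have h1 := Submodule.finrank_mono hle
  have hr : ∀ L : Finset κ, LinearIndepOn K W.col (L : Set κ) →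
      Module.finrank K (Submodule.span K (W.col '' (L : Set κ))) = L.card := by
    intro L hL
    have := finrank_span_eq_card (R := K) hL
    rw [Set.image_eq_range, this]
    exact Fintype.card_coe L
  rw [hr I hI, hr J hJ] at h1
  omega

/-- The matroid formed by the columns of a matrix. -/
def colMatroid {K ι κ : Type} [Field K] (W : Matrix ι κ K) : Matroid κ :=
  open Classical in
  (IndepMatroid.ofFinset Set.univ (ZeroNormControl.ColsIndep W) (colsIndep_empty W)
    (fun _ _ hJ h => hJ.subset h) (fun _ _ hI hJ h => hI.augment hJ h)
    (fun _ _ => Set.subset_univ _)).matroid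

theorem Pattern.colsIndep_iff {ι κ : Type} (P : Pattern ι κ) (I : Finset κ) :
    P.ColsIndep I ↔ ∃ M ∈ P.realizations, ZeroNormControl.ColsIndep M I := by
  classical
  unfold Pattern.ColsIndep Pattern.grank ZeroNormControl.ColsIndep
  set Q : Pattern ι I := P.submatrix id (Subtype.val : I → κ) with hQ
  have hbdd : BddAbove {r | ∃ M ∈ Pattern.realizations Q, M.rank = r} := by
    refine ⟨I.card, ?_⟩
    rintro r ⟨M, -, rfl⟩
    simpa using M.rank_le_card_width
  have hne : {r | ∃ M ∈ Pattern.realizations Q, M.rank = r}.Nonempty :=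
    ⟨_, 0, fun _ _ _ => rfl, rfl⟩
  constructor
  · intro h
    obtain ⟨M, hM, hr⟩ := Nat.sSup_mem hne hbdd
    refine ⟨Matrix.of fun i j => if hj : j ∈ I then M i ⟨j, hj⟩ else 0, ?_, ?_⟩
    · intro i j hij
      by_cases hj : j ∈ I
      · simpa [hj] using hM i ⟨j, hj⟩ hij
      · simp [hj]
    · rw [← h, ← hr]
      congr 1
      ext i j
      simp
  · rintro ⟨M, hM, hr⟩
    refine le_antisymm (csSup_le hne ?_) (le_csSup hbdd ?_)
    · rintro r ⟨N, -, rfl⟩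
      simpa using N.rank_le_card_width
    · exact ⟨_, fun i j hij => hM i j hij, hr⟩

theorem finite_not_colsIndep {ι κ : Type} [Fintype ι] (M N : Matrix ι κ ℝ) (I : Finset κ)
    (hM : ZeroNormControl.ColsIndep M I) :
    {t : ℝ | ¬ ZeroNormControl.ColsIndep (M + t • N) I}.Finite := by
  classical
  set S : Matrix ι κ ℝ → Matrix ι I ℝ := fun L => L.submatrix id (Subtype.val : I → κ) with hS
  set R : Matrix ι I (Polynomial ℝ) :=
    (S M).map (Polynomial.C : ℝ →+* Polynomial ℝ) +
      (Polynomial.X : Polynomial ℝ) • (S N).map (Polynomial.C : ℝ →+* Polynomial ℝ) with hR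
  have hev : ∀ t : ℝ, (Rᵀ * R).det.eval t = ((S (M + t • N))ᵀ * S (M + t • N)).det := by
    intro t
    have h1 : R.map (Polynomial.evalRingHom t) = S (M + t • N) := by
      ext i j
      simp only [hR, hS, Matrix.map_apply, Matrix.add_apply, Matrix.smul_apply,
        Matrix.submatrix_apply, smul_eq_mul, Polynomial.coe_evalRingHom, Polynomial.eval_add, Polynomial.eval_mul,
        Polynomial.eval_C, Polynomial.eval_X, id_eq]
    rw [← Polynomial.coe_evalRingHom, RingHom.map_det, RingHom.mapMatrix_apply, Matrix.map_mul,
      Matrix.transpose_map, h1]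
  have h0 : (Rᵀ * R).det ≠ 0 := by
    intro h
    have h2 := hev 0
    rw [h, zero_smul, add_zero, Polynomial.eval_zero] at h2
    have h3 : ((S M)ᵀ * S M).rank = Fintype.card I := by
      rw [Matrix.rank_transpose_mul_self, Fintype.card_coe]
      exact hM
    have h4 : LinearIndependent ℝ ((S M)ᵀ * S M).col := by
      rw [linearIndependent_iff_card_eq_finrank_span, ← h3, Matrix.rank_eq_finrank_span_cols]
      rfl
    rw [Matrix.linearIndependent_cols_iff_isUnit, Matrix.isUnit_iff_isUnit_det] at h4
    exact h4.ne_zero h2.symm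
  refine ((Rᵀ * R).det.rootSet ℝ).toFinite.subset ?_
  intro t ht
  rw [Polynomial.mem_rootSet]
  refine ⟨h0, ?_⟩
  by_contra hne
  refine ht ?_
  rw [Polynomial.coe_aeval_eq_eval, hev t] at hne
  have h5 := Matrix.rank_of_det_ne_zero hne
  rw [Matrix.rank_transpose_mul_self, Fintype.card_coe] at h5
  exact h5

theorem Pattern.ColsIndep.augment {ι κ : Type} [Fintype ι] [DecidableEq κ] {P : Pattern ι κ}
    {I J : Finset κ} (hI : P.ColsIndep I) (hJ : P.ColsIndep J) (h : I.card < J.card) :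
    ∃ e ∈ J, e ∉ I ∧ P.ColsIndep (insert e I) := by
  obtain ⟨M, hM, hMI⟩ := P.colsIndep_iff I |>.1 hI
  obtain ⟨N, hN, hNJ⟩ := P.colsIndep_iff J |>.1 hJ
  have f1 := finite_not_colsIndep M (N - M) I hMI
  have f2 := (finite_not_colsIndep N (M - N) J hNJ).image (fun s => 1 - s)
  obtain ⟨t, ht⟩ := (f1.union f2).exists_notMem
  rw [Set.mem_union, not_or] at ht
  have g1 : ZeroNormControl.ColsIndep (M + t • (N - M)) I := by
    by_contra hc
    exact ht.1 hc
  have g2 : ZeroNormControl.ColsIndep (M + t • (N - M)) J := by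
    by_contra hc
    refine ht.2 ⟨1 - t, ?_, by ring⟩
    have e1 : N + (1 - t) • (M - N) = M + t • (N - M) := by module
    show ¬ ZeroNormControl.ColsIndep (N + (1 - t) • (M - N)) J
    rwa [e1]
  obtain ⟨e, he, heI, hi⟩ := g1.augment g2 h
  refine ⟨e, he, heI, (P.colsIndep_iff _).2 ⟨_, ?_, hi⟩⟩
  intro i j hij
  simp [hM i j hij, hN i j hij]

/-- The matroid formed by the columns of a pattern. -/
def Pattern.colMatroid {ι κ : Type} [Fintype ι] (P : Pattern ι κ) : Matroid κ :=
  open Classical in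
  (IndepMatroid.ofFinset Set.univ P.ColsIndep
    ((P.colsIndep_iff ∅).2 ⟨0, fun _ _ _ => rfl, colsIndep_empty _⟩)
    (fun I J hJ h => by
      obtain ⟨M, hM, hMJ⟩ := (P.colsIndep_iff J).1 hJ
      exact (P.colsIndep_iff I).2 ⟨M, hM, hMJ.subset h⟩)
    (fun _ _ hI hJ h => hI.augment hJ h)
    (fun _ _ => Set.subset_univ _)).matroid

theorem colMatroid_indep {K ι κ : Type} [Field K] (W : Matrix ι κ K) (I : Finset κ) :
    (colMatroid W).Indep (I : Set κ) ↔ ZeroNormControl.ColsIndep W I := by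
  classical
  unfold colMatroid
  rw [IndepMatroid.matroid_Indep, IndepMatroid.ofFinset_indep]

theorem Pattern.colMatroid_indep {ι κ : Type} [Fintype ι] (P : Pattern ι κ) (I : Finset κ) :
    P.colMatroid.Indep (I : Set κ) ↔ P.ColsIndep I := by
  classical
  unfold Pattern.colMatroid
  rw [IndepMatroid.matroid_Indep, IndepMatroid.ofFinset_indep]

/-- The matroid intersection of `M₁` and `M₂` has cardinality `k`: the maximum size of a common
independent set is `k`. -/
def IntersectionCard {κ : Type} (M₁ M₂ : Matroid κ) (k : ℕ) : Prop :=
  IsGreatest {r | ∃ I : Finset κ, M₁.Indep (I : Set κ) ∧ M₂.Indep (I : Set κ) ∧ I.card = r} k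

/-! ### The auxiliary connection graph -/

/-- The resolvent `(λ I - A)⁻¹` as a matrix of rational functions in `λ`. -/
def ratResolvent {n : ℕ} (A : Matrix (Fin n) (Fin n) ℝ) : Matrix (Fin n) (Fin n) (RatFunc ℝ) :=
  (Matrix.scalar (Fin n) RatFunc.X - A.map RatFunc.C)⁻¹

/-- The transfer matrix with row blocks `(λ I - A)⁻¹` and `0`. -/
def Gzx {n : ℕ} (m : ℕ) (A : Matrix (Fin n) (Fin n) ℝ) :
    Matrix (Fin n ⊕ Fin m) (Fin n) (RatFunc ℝ) :=
  Matrix.fromRows (ratResolvent A) 0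

/-- The transfer matrix with row blocks `(λ I - A)⁻¹ B` and `I`. -/
def Gzu {n m : ℕ} (A : Matrix (Fin n) (Fin n) ℝ) (B : Matrix (Fin n) (Fin m) ℝ) :
    Matrix (Fin n ⊕ Fin m) (Fin m) (RatFunc ℝ) :=
  Matrix.fromRows (ratResolvent A * B.map RatFunc.C) 1

/-- The vertices `z`, `x` and `u` of the auxiliary connection graph; the `n + m` vertices `z` are
indexed by `Fin n ⊕ Fin m`. -/
inductive Vertex (n m : ℕ) : Type
  | z (i : Fin n ⊕ Fin m)
  | x (j : Fin n)
  | u (j : Fin m)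

/-- The directed edges of the auxiliary connection graph. -/
inductive Edge {n m : ℕ} (A : Matrix (Fin n) (Fin n) ℝ) (B : Matrix (Fin n) (Fin m) ℝ)
    (𝒜 : Pattern (Fin n) (Fin n)) (ℬ : Pattern (Fin n) (Fin m)) :
    Vertex n m → Vertex n m → Prop
  | xz (j : Fin n) (i : Fin n ⊕ Fin m) (h : Gzx m A i j ≠ 0) : Edge A B 𝒜 ℬ (.x j) (.z i)
  | uz (j : Fin m) (i : Fin n ⊕ Fin m) (h : Gzu A B i j ≠ 0) : Edge A B 𝒜 ℬ (.u j) (.z i)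
  | zx (i : Fin n ⊕ Fin m) (j : Fin n) (h : Matrix.fromCols 𝒜 ℬ j i ≠ Entry.zero) :
      Edge A B 𝒜 ℬ (.z i) (.x j)

/-- The auxiliary connection graph. -/
def auxGraph {n m : ℕ} (A : Matrix (Fin n) (Fin n) ℝ) (B : Matrix (Fin n) (Fin m) ℝ)
    (𝒜 : Pattern (Fin n) (Fin n)) (ℬ : Pattern (Fin n) (Fin m)) : Digraph (Vertex n m) where
  Adj := Edge A B 𝒜 ℬ

/-- A vertex is input-reachable if some directed path leads to it from a vertex `u`. -/
def InputReachable {n m : ℕ} (G : Digraph (Vertex n m)) (v : Vertex n m) : Prop :=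
  ∃ j : Fin m, Relation.ReflTransGen G.Adj (.u j) v

/-! ### The conditions -/

/-- The complex matrix `[λ I - A, B]`. -/
def pencil {n m : ℕ} (A : Matrix (Fin n) (Fin n) ℝ) (B : Matrix (Fin n) (Fin m) ℝ) (μ : ℂ) :
    Matrix (Fin n) (Fin n ⊕ Fin m) ℂ :=
  Matrix.fromCols (Matrix.scalar (Fin n) μ - A.map Complex.ofReal) (B.map Complex.ofReal)

/-- The set of complex eigenvalues of a real matrix. -/
def eigenvalues {n : ℕ} (A : Matrix (Fin n) (Fin n) ℝ) : Set ℂ :=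
  {μ | Module.End.HasEigenvalue (Matrix.toLin' (A.map Complex.ofReal)) μ}

/-- The maximum of `rank [μ I - A - ΔA, B + ΔB]` over `ΔA ∈ [𝒜]`, `ΔB ∈ [ℬ]` is `k`. -/
def MaxRankPerturbedPencil {n m : ℕ} (A : Matrix (Fin n) (Fin n) ℝ)
    (B : Matrix (Fin n) (Fin m) ℝ) (𝒜 : Pattern (Fin n) (Fin n)) (ℬ : Pattern (Fin n) (Fin m))
    (μ : ℂ) (k : ℕ) : Prop :=
  IsGreatest {r | ∃ ΔA ∈ 𝒜.realizations, ∃ ΔB ∈ ℬ.realizations,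
    (pencil (A + ΔA) (B + ΔB) μ).rank = r} k

/-- The edge from `x j` to `z i` is input-reachable: one of its two ends is. -/
def XZEdgeReachable {n m : ℕ} (G : Digraph (Vertex n m)) (j : Fin n) (i : Fin n ⊕ Fin m) : Prop :=
  InputReachable G (.x j) ∨ InputReachable G (.z i)

end ZeroNormControl

end

/-!
Write `F = [A, B]`. By the Hautus test, `(A, B)` is controllable exactly if for no `μ : ℂ` there is a
nonzero row vector `v` with `v A = μ v` and `v B = 0` (`controllable_iff_hautus`). The problem thus
becomes one about the modes `μ` at which all perturbations, or a well-chosen one, fail the test.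

*Sufficiency* (`exists_hautus_of_reach`). The rank condition is needed at the eigenvalues of `A` only:
at any other `μ` the unperturbed system passes the test. The free entries are then fixed one at a
time, at generic real values, by induction on their number, with two invariants.
Reachability of all vertices `z` is kept, because the transfer matrix `G = [Gzx, Gzu]` changes by
`G' = G + t G E G'` for a matrix unit `E`, so that a path through the removed connection becomes an
edge (`finite_not_reach_add_single`). Solvability of the rank condition at every `μ` is kept,
because an entry in column `j` can create uncontrollable modes only at the finitely many zeros of the
transfer from the inputs to `j` and of the characteristic polynomial, for a suitable choice of the
other entries that makes this transfer nonzero (`finite_not_hautus_add_single`); and at each single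
`μ` only finitely many values of the entry are bad. When no free entry is left, the Hautus test
holds at every `μ`.

*Necessity of reachability* (`reach_of_hautus`). An unreachable vertex gives a nonzero space of
row vectors that is invariant under `A + ΔA` and annihilated by `B + ΔB`, for every perturbation.

*The matroid condition* (`intersectionCard_iff`). Since `Q + Δ = [I, Q] [Δ; I]`, the Cauchy–Binet
formula turns full rank of `Q + Δ` into a common independent set of size `n`. Conversely, a common
independent set makes `[I, Q] diag(x) [D; diag d]` of full rank for generic weights `x`.
-/

namespace ZeroNormControl

/-! ### Full row rank and the Hautus test -/

theorem rank_eq_iff_vecMul_injective {K κ : Type} [Field K] [Fintype κ] {n : ℕ}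
    (M : Matrix (Fin n) κ K) : M.rank = n ↔ ∀ v : Fin n → K, v ᵥ* M = 0 → v = 0 := by
  classical
  have h := linearIndependent_iff_card_eq_finrank_span (R := K) (b := M.row)
  rw [Fintype.card_fin, Set.finrank, ← Matrix.rank_eq_finrank_span_row, eq_comm,
    ← Matrix.vecMul_injective_iff] at h
  rw [← h]
  constructor
  · intro hi v hv
    exact hi (hv.trans (Matrix.zero_vecMul M).symm)
  · intro hi v w hvw
    rw [← sub_eq_zero]
    apply hi
    rw [Matrix.sub_vecMul, sub_eq_zero]
    exact hvw

theorem exists_right_inverse_of_rank_eq {K κ : Type} [Field K] [Fintype κ] {n : ℕ}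
    (M : Matrix (Fin n) κ K) (hM : M.rank = n) : ∃ Y : Matrix κ (Fin n) K, M * Y = 1 := by
  have hrange : LinearMap.range M.mulVecLin = ⊤ := by
    apply Submodule.eq_top_of_finrank_eq
    rw [Module.finrank_fin_fun]
    exact hM
  exact Matrix.mulVec_surjective_iff_exists_right_inverse.1 (LinearMap.range_eq_top.1 hrange)

/-- Full row rank persists along a line, except at finitely many real parameters: after
multiplication by a right inverse `Y` of `M`, the determinant of `(M + t N) Y` is a polynomial in `t`
with value one at zero. -/
theorem finite_not_rank_add_smul {K κ : Type} [Field K] [Algebra ℝ K] [Fintype κ] {n : ℕ}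
    (M N : Matrix (Fin n) κ K) (hM : M.rank = n) :
    {t : ℝ | (M + algebraMap ℝ K t • N).rank ≠ n}.Finite := by
  classical
  obtain ⟨Y, hY⟩ := exists_right_inverse_of_rank_eq M hM
  set p : Polynomial K := (1 + (Polynomial.X : Polynomial K) •
    (N * Y).map (Polynomial.C : K →+* Polynomial K)).det with hp
  have hev : ∀ s : K, p.eval s = ((M + s • N) * Y).det := by
    intro s
    rw [hp, ← Polynomial.coe_evalRingHom, RingHom.map_det, RingHom.mapMatrix_apply,
      Matrix.add_mul, hY, Matrix.smul_mul]
    congr 1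
    ext i j
    by_cases hij : i = j <;> simp [hij, -Matrix.map_mul, mul_comm s]
  have hp0 : p ≠ 0 := by
    intro h
    have := hev 0
    rw [h, zero_smul, add_zero, hY] at this
    simp at this
  refine (Set.Finite.preimage (algebraMap ℝ K).injective.injOn
    (Polynomial.finite_setOfPred_isRoot hp0)).subset ?_
  intro t ht
  by_contra hne
  apply ht
  rw [Set.mem_preimage, Set.mem_ofPred_eq, Polynomial.IsRoot, hev] at hne
  have h1 := Matrix.rank_of_det_ne_zero hne
  have h2 := Matrix.rank_mul_le_left (M + algebraMap ℝ K t • N) Y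
  have h3 := (M + algebraMap ℝ K t • N).rank_le_card_height
  rw [Fintype.card_fin] at h1 h3
  omega

/-- The Popov–Belevitch–Hautus condition at `μ` for the real matrix `F = [A, B]`: there is no
nonzero row vector `v` with `v A = μ v` and `v B = 0`. -/
def Hautus {n m : ℕ} (F : Matrix (Fin n) (Fin n ⊕ Fin m) ℝ) (μ : ℂ) : Prop :=
  ∀ v : Fin n → ℂ, v ᵥ* F.map Complex.ofReal = Sum.elim (μ • v) 0 → v = 0

theorem vecMul_pencil_eq_zero_iff {n m : ℕ} (A : Matrix (Fin n) (Fin n) ℝ)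
    (B : Matrix (Fin n) (Fin m) ℝ) (μ : ℂ) (v : Fin n → ℂ) :
    v ᵥ* pencil A B μ = 0 ↔
      v ᵥ* A.map Complex.ofReal = μ • v ∧ v ᵥ* B.map Complex.ofReal = 0 := by
  have h1 : v ᵥ* Matrix.scalar (Fin n) μ = μ • v := by
    ext i
    simp [Matrix.vecMul_diagonal, mul_comm]
  rw [pencil, Matrix.vecMul_fromCols, Matrix.vecMul_sub, h1]
  rw [show (0 : Fin n ⊕ Fin m → ℂ) =
      Sum.elim (0 : Fin n → ℂ) (0 : Fin m → ℂ) from by ext i; cases i <;> rfl,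
    Sum.elim_eq_iff, sub_eq_zero]
  exact and_congr_left fun _ => eq_comm

theorem vecMul_fromCols_map_eq_iff {n m : ℕ} (A : Matrix (Fin n) (Fin n) ℝ)
    (B : Matrix (Fin n) (Fin m) ℝ) (μ : ℂ) (v : Fin n → ℂ) :
    v ᵥ* (Matrix.fromCols A B).map Complex.ofReal = Sum.elim (μ • v) 0 ↔
      v ᵥ* A.map Complex.ofReal = μ • v ∧ v ᵥ* B.map Complex.ofReal = 0 := by
  rw [Matrix.fromCols_map, Matrix.vecMul_fromCols, Sum.elim_eq_iff]

theorem rank_pencil_eq_iff {n m : ℕ} (A : Matrix (Fin n) (Fin n) ℝ)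
    (B : Matrix (Fin n) (Fin m) ℝ) (μ : ℂ) :
    (pencil A B μ).rank = n ↔ Hautus (Matrix.fromCols A B) μ := by
  rw [rank_eq_iff_vecMul_injective, Hautus]
  simp only [vecMul_pencil_eq_zero_iff, vecMul_fromCols_map_eq_iff]

theorem rank_pencil_of_notMem_eigenvalues {n m : ℕ} (A : Matrix (Fin n) (Fin n) ℝ)
    (B : Matrix (Fin n) (Fin m) ℝ) {μ : ℂ} (hμ : μ ∉ eigenvalues A) :
    (pencil A B μ).rank = n := by
  rw [rank_eq_iff_vecMul_injective]
  intro v hv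
  have h1 := ((vecMul_pencil_eq_zero_iff A B μ v).1 hv).1
  by_contra hne
  apply hμ
  have h2 : ∃ w : Fin n → ℂ, w ≠ 0 ∧
      (Matrix.scalar (Fin n) μ - A.map Complex.ofReal) *ᵥ w = 0 := by
    rw [Matrix.exists_mulVec_eq_zero_iff, ← Matrix.exists_vecMul_eq_zero_iff]
    refine ⟨v, hne, ?_⟩
    rw [Matrix.vecMul_sub, h1, sub_eq_zero]
    ext i
    simp [Matrix.vecMul_diagonal, mul_comm]
  obtain ⟨w, hw, hw2⟩ := h2
  refine Module.End.hasEigenvalue_of_hasEigenvector (x := w) ⟨?_, hw⟩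
  rw [Module.End.mem_eigenspace_iff, Matrix.toLin'_apply]
  rw [Matrix.sub_mulVec, sub_eq_zero] at hw2
  rw [← hw2]
  ext i
  simp [Matrix.mulVec_diagonal]

/-- A nonzero real space of row vectors that is invariant under `A` and annihilated by `B` contains,
after complexification, an eigenvector at which the Hautus test fails. -/
theorem exists_not_hautus_of_invariant {n m : ℕ} (A : Matrix (Fin n) (Fin n) ℝ)
    (B : Matrix (Fin n) (Fin m) ℝ) (V : Submodule ℝ (Fin n → ℝ)) (hV : V ≠ ⊥)
    (hA : ∀ v ∈ V, v ᵥ* A ∈ V) (hB : ∀ v ∈ V, v ᵥ* B = 0) :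
    ∃ μ : ℂ, ¬ Hautus (Matrix.fromCols A B) μ := by
  let re : (Fin n → ℂ) → Fin n → ℝ := fun v i => (v i).re
  let im : (Fin n → ℂ) → Fin n → ℝ := fun v i => (v i).im
  have hre : ∀ {k : ℕ} (v : Fin n → ℂ) (M : Matrix (Fin n) (Fin k) ℝ) (i : Fin k),
      ((v ᵥ* M.map Complex.ofReal) i).re = (re v ᵥ* M) i := by
    intro k v M i
    simp [Matrix.vecMul, dotProduct, re]
  have him : ∀ {k : ℕ} (v : Fin n → ℂ) (M : Matrix (Fin n) (Fin k) ℝ) (i : Fin k),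
      ((v ᵥ* M.map Complex.ofReal) i).im = (im v ᵥ* M) i := by
    intro k v M i
    simp [Matrix.vecMul, dotProduct, im]
  let W : Submodule ℂ (Fin n → ℂ) :=
    { carrier := {v | re v ∈ V ∧ im v ∈ V}
      add_mem' := by
        rintro a b ⟨ha, ha'⟩ ⟨hb, hb'⟩
        exact ⟨V.add_mem ha hb, V.add_mem ha' hb'⟩
      zero_mem' := ⟨V.zero_mem, V.zero_mem⟩
      smul_mem' := by
        rintro c a ⟨ha, ha'⟩
        constructor
        · have : re (c • a) = c.re • re a - c.im • im a := by
            ext i; simp [re, im]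
          rw [this]
          exact V.sub_mem (V.smul_mem _ ha) (V.smul_mem _ ha')
        · have : im (c • a) = c.re • im a + c.im • re a := by
            ext i; simp [re, im]
          rw [this]
          exact V.add_mem (V.smul_mem _ ha') (V.smul_mem _ ha) }
  obtain ⟨v0, hv0, hv0ne⟩ := (Submodule.ne_bot_iff V).1 hV
  have hWne : Nontrivial W := by
    rw [Submodule.nontrivial_iff_ne_bot, Submodule.ne_bot_iff]
    refine ⟨fun i => (v0 i : ℂ), ⟨?_, ?_⟩, ?_⟩
    · simpa [re] using hv0
    · have : im (fun i => (v0 i : ℂ)) = 0 := by ext i; simp [im]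
      rw [this]
      exact V.zero_mem
    · intro h
      apply hv0ne
      ext i
      simpa using congrFun h i
  have hinv : ∀ v ∈ W, (A.map Complex.ofReal).vecMulLinear v ∈ W := by
    rintro v ⟨h1, h2⟩
    refine ⟨?_, ?_⟩
    · have : re ((A.map Complex.ofReal).vecMulLinear v) = re v ᵥ* A := funext fun i => hre v A i
      rw [this]
      exact hA _ h1
    · have : im ((A.map Complex.ofReal).vecMulLinear v) = im v ᵥ* A := funext fun i => him v A i
      rw [this]
      exact hA _ h2
  obtain ⟨μ, hμ⟩ := Module.End.exists_eigenvalue (((A.map Complex.ofReal).vecMulLinear).restrict hinv)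
  obtain ⟨w, hw⟩ := hμ.exists_hasEigenvector
  refine ⟨μ, fun hH => hw.2 ?_⟩
  have h1 := congrArg Subtype.val hw.apply_eq_smul
  have h2 : (w : Fin n → ℂ) = 0 := by
    refine hH _ ((vecMul_fromCols_map_eq_iff A B μ _).2 ⟨h1, ?_⟩)
    ext i
    apply Complex.ext
    · rw [hre, hB _ w.2.1]; rfl
    · rw [him, hB _ w.2.2]; rfl
  exact Subtype.ext h2

theorem fromCols_add_fromCols {R ι κ κ' : Type} [Add R] (A A' : Matrix ι κ R) (B B' : Matrix ι κ' R) :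
    Matrix.fromCols A B + Matrix.fromCols A' B' = Matrix.fromCols (A + A') (B + B') := by
  ext i j
  rcases j with j | j <;> rfl

/-! ### Controllability and the Hautus test -/

theorem Controllable.hautus {n m : ℕ} {A : Matrix (Fin n) (Fin n) ℝ}
    {B : Matrix (Fin n) (Fin m) ℝ} (h : Controllable A B) (μ : ℂ) :
    Hautus (Matrix.fromCols A B) μ := by
  intro v hv
  rw [vecMul_fromCols_map_eq_iff] at hv
  obtain ⟨hvA, hvB⟩ := hv
  let L : (Fin n → ℝ) →L[ℝ] ℂ := LinearMap.toContinuousLinearMap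
    { toFun := fun y => v ⬝ᵥ fun i => (y i : ℂ)
      map_add' := by
        intro y z
        simp [dotProduct, mul_add, Finset.sum_add_distrib]
      map_smul' := by
        intro c y
        simp only [dotProduct, Pi.smul_apply, smul_eq_mul, Complex.ofReal_mul, RingHom.id_apply,
          Complex.real_smul, Finset.mul_sum]
        exact Finset.sum_congr rfl fun i _ => by ring }
  have hLdef : ∀ y, L y = v ⬝ᵥ fun i => (y i : ℂ) := fun y => rfl
  have hcast : ∀ {k : ℕ} (M : Matrix (Fin n) (Fin k) ℝ) (y : Fin k → ℝ),
      L (M *ᵥ y) = (v ᵥ* M.map Complex.ofReal) ⬝ᵥ fun i => (y i : ℂ) := by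
    intro k M y
    rw [hLdef, ← Matrix.dotProduct_mulVec]
    congr 1
    ext i
    simp [Matrix.mulVec, dotProduct]
  have hL : ∀ (y : Fin n → ℝ) (w : Fin m → ℝ), L (A *ᵥ y + B *ᵥ w) = μ * L y := by
    intro y w
    rw [map_add, hcast, hcast, hvA, hvB, zero_dotProduct, add_zero, smul_dotProduct, hLdef,
      smul_eq_mul]
  -- the functional `L` vanishes along every trajectory that starts at the origin
  have key : ∀ x₁ : Fin n → ℝ, L x₁ = 0 := by
    intro x₁
    obtain ⟨T, hT, u, hu, x, hxc, hx, hxT⟩ := h 0 x₁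
    set w : ℝ → ℂ := Set.IccExtend hT.le (fun t : Set.Icc 0 T => L (x t)) with hw
    have hwc : Continuous w := by
      apply Continuous.Icc_extend'
      exact L.continuous.comp (continuousOn_iff_continuous_domRestrict.1 hxc)
    have hweq : ∀ t ∈ Set.Icc 0 T, w t = L (x t) := fun t ht =>
      Set.IccExtend_of_mem hT.le _ ht
    set F : ℝ → ℂ := fun t => ∫ s in (0 : ℝ)..t, μ * w s with hF
    have hFd : ∀ t, HasDerivAt F (μ * w t) t := fun t =>
      (Continuous.integral_hasStrictDerivAt (continuous_const.mul hwc) 0 t).hasDerivAt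
    have hFw : ∀ t ∈ Set.Icc 0 T, F t = w t := by
      intro t ht
      have hsub : Set.uIcc 0 t ⊆ Set.Icc 0 T := by
        rw [Set.uIcc_of_le ht.1]
        exact Set.Icc_subset_Icc_right ht.2
      have hA : IntervalIntegrable (fun s => A *ᵥ x s) MeasureTheory.volume 0 t := by
        apply ContinuousOn.intervalIntegrable
        exact (A.mulVecLin.continuous_of_finiteDimensional).comp_continuousOn (hxc.mono hsub)
      have hB : IntervalIntegrable (fun s => B *ᵥ u s) MeasureTheory.volume 0 t := by
        have h1 : IntervalIntegrable u MeasureTheory.volume 0 t := hu.mono_set (by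
          rw [Set.uIcc_of_le hT.le]
          exact hsub)
        have h2 := (LinearMap.toContinuousLinearMap B.mulVecLin).integrable_comp h1.1
        have h3 := (LinearMap.toContinuousLinearMap B.mulVecLin).integrable_comp h1.2
        exact ⟨h2, h3⟩
      rw [hweq t ht, hx t ht, zero_add, ← L.intervalIntegral_comp_comm (hA.add hB)]
      apply intervalIntegral.integral_congr
      intro s hs
      simp only [hL, hweq s (hsub hs)]
    have hF0 := eq_zero_of_abs_deriv_le_mul_abs_self_of_eq_zero_right (f := F)
      (f' := fun t => μ * w t) (K := ‖μ‖) (a := 0) (b := T)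
      (fun t _ => (hFd t).continuousAt.continuousWithinAt)
      (fun t _ => (hFd t).hasDerivWithinAt) (by simp [hF])
      (fun t ht => by rw [hFw t ⟨ht.1, ht.2.le⟩, norm_mul]) T ⟨hT.le, le_rfl⟩
    rw [← hxT, ← hweq T ⟨hT.le, le_rfl⟩, ← hFw T ⟨hT.le, le_rfl⟩, hF0]
  ext i
  have h1 := key (Pi.single i 1)
  rw [hLdef] at h1
  simpa [dotProduct, Pi.single_apply, apply_ite Complex.ofReal] using h1

open NormedSpace in
theorem exp_smul_mul_exp_neg_smul {𝔸 : Type} [NormedRing 𝔸] [NormedAlgebra ℝ 𝔸] [CompleteSpace 𝔸]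
    (a : 𝔸) (t : ℝ) : exp (t • a) * exp ((-t) • a) = 1 := by
  let _ : NormedAlgebra ℚ 𝔸 := NormedAlgebra.restrictScalars ℚ ℝ 𝔸
  rw [← exp_add_of_commute ((Commute.refl a).smul_left t |>.smul_right (-t)), ← add_smul,
    add_neg_cancel, zero_smul, exp_zero]

open NormedSpace in
/-- The variation of constants formula, for a continuous input. -/
theorem variation_of_constants {E U : Type} [NormedAddCommGroup E] [NormedSpace ℝ E]
    [CompleteSpace E] [NormedAddCommGroup U] [NormedSpace ℝ U] (a : E →L[ℝ] E) (b : U →L[ℝ] E)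
    {u : ℝ → U} (hu : Continuous u) (x₀ : E) (t : ℝ) :
    HasDerivAt (fun t : ℝ => exp (t • a) (x₀ + ∫ s in (0 : ℝ)..t, exp ((-s) • a) (b (u s))))
      (a (exp (t • a) (x₀ + ∫ s in (0 : ℝ)..t, exp ((-s) • a) (b (u s)))) + b (u t)) t := by
  have hc : Continuous fun s : ℝ => exp ((-s) • a) (b (u s)) := by
    have h1 : Continuous fun s : ℝ => exp ((-s) • a) :=
      (continuous_iff_continuousAt.2 fun s =>
        (hasDerivAt_exp_smul_const a s).continuousAt).comp continuous_neg
    exact h1.clm_apply (b.continuous.comp hu)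
  have h1 := ((Continuous.integral_hasStrictDerivAt hc 0 t).hasDerivAt).const_add x₀
  have h2 := (hasDerivAt_exp_smul_const' a t).clm_apply h1
  have h3 : exp (t • a) * exp ((-t) • a) = 1 := exp_smul_mul_exp_neg_smul a t
  convert h2 using 1
  congr 1
  change _ = (exp (t • a) * exp ((-t) • a)) (b (u t))
  rw [h3]
  rfl

open NormedSpace in
/-- If the Hautus test holds everywhere, then the system is controllable. The states reachable from
the origin in unit time with continuous inputs form a subspace. A functional `φ` that vanishes on
it satisfies `φ exp(-s A) B = 0` on `[0, 1]`; such functionals form an `A`-invariant space that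
annihilates the columns of `B`. -/
theorem controllable_of_hautus {n m : ℕ} {A : Matrix (Fin n) (Fin n) ℝ}
    {B : Matrix (Fin n) (Fin m) ℝ} (h : ∀ μ : ℂ, Hautus (Matrix.fromCols A B) μ) :
    Controllable A B := by
  let a : (Fin n → ℝ) →L[ℝ] (Fin n → ℝ) := LinearMap.toContinuousLinearMap A.mulVecLin
  let b : (Fin m → ℝ) →L[ℝ] (Fin n → ℝ) := LinearMap.toContinuousLinearMap B.mulVecLin
  have hexp : Continuous fun s : ℝ => exp ((-s) • a) :=
    (continuous_iff_continuousAt.2 fun s =>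
      (hasDerivAt_exp_smul_const a s).continuousAt).comp continuous_neg
  have hcont : ∀ u : ℝ → Fin m → ℝ, Continuous u →
      Continuous fun s : ℝ => exp ((-s) • a) (b (u s)) := fun u hu =>
    hexp.clm_apply (b.continuous.comp hu)
  let R : Submodule ℝ (Fin n → ℝ) :=
    { carrier := {c | ∃ u : ℝ → Fin m → ℝ, Continuous u ∧
        ∫ s in (0 : ℝ)..1, exp ((-s) • a) (b (u s)) = c}
      add_mem' := by
        rintro _ _ ⟨u, hu, rfl⟩ ⟨w, hw, rfl⟩
        refine ⟨u + w, hu.add hw, ?_⟩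
        rw [← intervalIntegral.integral_add ((hcont u hu).intervalIntegrable _ _)
          ((hcont w hw).intervalIntegrable _ _)]
        simp
      zero_mem' := ⟨0, continuous_zero, by simp⟩
      smul_mem' := by
        rintro c _ ⟨u, hu, rfl⟩
        refine ⟨c • u, hu.const_smul c, ?_⟩
        rw [← intervalIntegral.integral_smul]
        simp }
  have hR : R = ⊤ := by
    by_contra hne
    obtain ⟨f, hf, hfR⟩ := Submodule.exists_le_ker_of_lt_top R (lt_top_iff_ne_top.2 hne)
    -- row vectors, acting on states by the dot product
    let ev : (Fin n → ℝ) → (Fin n → ℝ) →L[ℝ] ℝ := fun v =>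
      LinearMap.toContinuousLinearMap (dotProductBilin ℝ ℝ v)
    have hev : ∀ v y, ev v y = v ⬝ᵥ y := fun v y => rfl
    let V : Submodule ℝ (Fin n → ℝ) :=
      { carrier := {v | ∀ s ∈ Set.Icc (0 : ℝ) 1, ∀ w, v ⬝ᵥ exp ((-s) • a) (b w) = 0}
        add_mem' := by
          intro v w hv hw s hs y
          rw [add_dotProduct, hv s hs, hw s hs, add_zero]
        zero_mem' := by
          intro s hs y
          rw [zero_dotProduct]
        smul_mem' := by
          intro c v hv s hs y
          rw [smul_dotProduct, hv s hs, smul_zero] }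
    have hVne : V ≠ ⊥ := by
      rw [Submodule.ne_bot_iff]
      refine ⟨fun i => f (Pi.single i 1), ?_, ?_⟩
      · have hfdot : ∀ y, (fun i => f (Pi.single i 1)) ⬝ᵥ y = f y := by
          intro y
          conv_rhs => rw [← Finset.univ_sum_single y, map_sum]
          refine Finset.sum_congr rfl fun i _ => ?_
          rw [mul_comm, ← smul_eq_mul, ← map_smul, ← Pi.single_smul, smul_eq_mul, mul_one]
        intro s hs w
        rw [hfdot]
        let g : ℝ → ℝ := fun s => f (exp ((-s) • a) (b w))
        have hg : Continuous g :=
          f.continuous_of_finiteDimensional.comp (hcont (fun _ => w) continuous_const)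
        -- the input `g w`, against which `f` integrates to the integral of `g ^ 2`
        have h1 : f (∫ s in (0 : ℝ)..1, exp ((-s) • a) (b (g s • w))) = 0 :=
          hfR ⟨fun s => g s • w, hg.smul continuous_const, rfl⟩
        have h2 := (LinearMap.toContinuousLinearMap f).intervalIntegral_comp_comm
          ((hcont (fun s => g s • w) (hg.smul continuous_const)).intervalIntegrable
            (μ := MeasureTheory.volume) 0 1)
        have h3 : ∫ s in (0 : ℝ)..1, g s * g s = 0 := by
          refine Eq.trans (Eq.trans ?_ h2) h1
          apply intervalIntegral.integral_congr
          intro s _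
          simp [g]
        by_contra hgs
        have := intervalIntegral.integral_pos zero_lt_one (hg.mul hg).continuousOn
          (fun x _ => mul_self_nonneg (g x)) ⟨s, hs, mul_self_pos.2 hgs⟩
        exact this.ne' h3
      · intro h0
        apply hf
        ext i
        simpa using congrFun h0 i
    have hVA : ∀ v ∈ V, v ᵥ* A ∈ V := by
      intro v hv s hs w
      -- `exp(-s a) b w` has derivative `-a exp(-s a) b w`, and `v` is orthogonal to it on `[0, 1]`
      have hd : HasDerivAt (fun s : ℝ => ev v (exp ((-s) • a) (b w)))
          (ev v (-(a (exp ((-s) • a) (b w))))) s := by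
        have h1 := (hasDerivAt_exp_smul_const' a (-s)).scomp s (hasDerivAt_neg s)
        have h2 := (ev v).hasFDerivAt.comp_hasDerivAt s (h1.clm_apply (hasDerivAt_const s (b w)))
        refine HasDerivAt.congr_deriv h2 ?_
        rw [map_zero, add_zero, neg_one_smul]
        rfl
      have hz : HasDerivWithinAt (fun s : ℝ => ev v (exp ((-s) • a) (b w))) 0
          (Set.Icc 0 1) s := by
        refine (hasDerivWithinAt_const s (Set.Icc (0 : ℝ) 1) (0 : ℝ)).congr ?_ ?_
        · intro y hy
          exact hv y hy w
        · exact hv s hs w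
      have h3 := (uniqueDiffOn_Icc zero_lt_one s hs).eq_deriv _ hd.hasDerivWithinAt hz
      rw [map_neg, neg_eq_zero, hev] at h3
      rw [← Matrix.dotProduct_mulVec]
      exact h3
    have hVB : ∀ v ∈ V, v ᵥ* B = 0 := by
      intro v hv
      ext j
      have h1 := hv 0 ⟨le_rfl, zero_le_one⟩ (Pi.single j 1)
      rw [neg_zero, zero_smul, exp_zero] at h1
      have h2 : v ⬝ᵥ (B *ᵥ Pi.single j 1) = 0 := h1
      rwa [Matrix.dotProduct_mulVec, dotProduct_single, mul_one] at h2
    obtain ⟨μ, hμ⟩ := exists_not_hautus_of_invariant A B V hVne hVA hVB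
    exact hμ (h μ)
  intro x₀ x₁
  have hmem : exp ((-1 : ℝ) • a) x₁ - x₀ ∈ R := hR ▸ Submodule.mem_top
  obtain ⟨u, hu, hint⟩ := hmem
  let x : ℝ → Fin n → ℝ := fun t =>
    exp (t • a) (x₀ + ∫ s in (0 : ℝ)..t, exp ((-s) • a) (b (u s)))
  have hxd : ∀ t, HasDerivAt x (a (x t) + b (u t)) t := fun t =>
    variation_of_constants a b hu x₀ t
  have hxc : Continuous x := continuous_iff_continuousAt.2 fun t => (hxd t).continuousAt
  refine ⟨1, zero_lt_one, u, hu.intervalIntegrable _ _, x, hxc.continuousOn, ?_, ?_⟩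
  · intro t _
    have h1 := intervalIntegral.integral_eq_sub_of_hasDerivAt (a := 0) (b := t)
      (fun s _ => hxd s) (((a.continuous.comp hxc).add (b.continuous.comp hu)).intervalIntegrable _ _)
    have h2 : x 0 = x₀ := by simp [x]
    rw [h2] at h1
    exact (add_eq_of_eq_sub' h1).symm
  · have h3 : exp ((1 : ℝ) • a) * exp ((-1 : ℝ) • a) = 1 :=
      exp_smul_mul_exp_neg_smul a 1
    change exp ((1 : ℝ) • a) (x₀ + ∫ s in (0 : ℝ)..1, exp ((-s) • a) (b (u s))) = x₁
    rw [hint, add_sub_cancel]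
    change (exp ((1 : ℝ) • a) * exp ((-1 : ℝ) • a)) x₁ = x₁
    rw [h3]
    rfl

theorem controllable_iff_hautus {n m : ℕ} (A : Matrix (Fin n) (Fin n) ℝ)
    (B : Matrix (Fin n) (Fin m) ℝ) :
    Controllable A B ↔ ∀ μ : ℂ, Hautus (Matrix.fromCols A B) μ :=
  ⟨fun h μ => h.hautus μ, controllable_of_hautus⟩

/-! ### The transfer matrix of the auxiliary connection graph -/

/-- For `F = [A, B]` the square matrix with block rows `[x I - A, -B]` and `[0, I]`. Over the
rational functions, at `x = X`, its inverse is `[Gzx, Gzu]`. -/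
def sysMatrix {R : Type} [CommRing R] {n m : ℕ} (x : R) (F : Matrix (Fin n) (Fin n ⊕ Fin m) R) :
    Matrix (Fin n ⊕ Fin m) (Fin n ⊕ Fin m) R :=
  Matrix.diagonal (Sum.elim (fun _ => x) fun _ => 1) - Matrix.fromRows F 0

theorem sysMatrix_fromCols {R : Type} [CommRing R] {n m : ℕ} (x : R)
    (A : Matrix (Fin n) (Fin n) R) (B : Matrix (Fin n) (Fin m) R) :
    sysMatrix x (Matrix.fromCols A B) =
      Matrix.fromBlocks (Matrix.scalar (Fin n) x - A) (-B) 0 1 := by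
  ext i j
  rcases i with i | i <;> rcases j with j | j <;>
    simp [sysMatrix, Matrix.diagonal_apply, Matrix.one_apply]

theorem sysMatrix_map {R S : Type} [CommRing R] [CommRing S] (f : R →+* S) {n m : ℕ} (x : R)
    (F : Matrix (Fin n) (Fin n ⊕ Fin m) R) :
    (sysMatrix x F).map f = sysMatrix (f x) (F.map f) := by
  ext i j
  rcases i with i | i <;> rcases j with j | j <;>
    simp [sysMatrix, Matrix.diagonal_apply, apply_ite f]

theorem sysMatrix_add_single {R : Type} [CommRing R] {n m : ℕ} (x : R)
    (F : Matrix (Fin n) (Fin n ⊕ Fin m) R) (i : Fin n) (j : Fin n ⊕ Fin m) (t : R) :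
    sysMatrix x (F + Matrix.single i j t) = sysMatrix x F - Matrix.single (Sum.inl i) j t := by
  ext a b
  rcases a with a | a
  · simp [sysMatrix, Matrix.single_apply, sub_sub]
  · simp [sysMatrix]

theorem det_sysMatrix_X_ne_zero {n m : ℕ} (F : Matrix (Fin n) (Fin n ⊕ Fin m) ℝ) :
    (sysMatrix Polynomial.X (F.map (Polynomial.C : ℝ →+* Polynomial ℝ))).det ≠ 0 := by
  obtain ⟨A, B, rfl⟩ : ∃ A B, F = Matrix.fromCols A B :=
    ⟨_, _, (Matrix.fromCols_toCols F).symm⟩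
  rw [Matrix.fromCols_map, sysMatrix_fromCols, Matrix.det_fromBlocks_zero₂₁, Matrix.det_one,
    mul_one]
  exact (Matrix.charpoly_monic A).ne_zero

theorem algebraMap_sysMatrix {n m : ℕ} (F : Matrix (Fin n) (Fin n ⊕ Fin m) ℝ) :
    (sysMatrix Polynomial.X (F.map (Polynomial.C : ℝ →+* Polynomial ℝ))).map
      (algebraMap (Polynomial ℝ) (RatFunc ℝ)) = sysMatrix RatFunc.X (F.map RatFunc.C) := by
  rw [sysMatrix_map, RatFunc.algebraMap_X, Matrix.map_map]
  rfl

theorem isUnit_det_sysMatrix {n m : ℕ} (F : Matrix (Fin n) (Fin n ⊕ Fin m) ℝ) :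
    IsUnit (sysMatrix RatFunc.X (F.map RatFunc.C)).det := by
  rw [← algebraMap_sysMatrix, ← RingHom.mapMatrix_apply, ← RingHom.map_det, isUnit_iff_ne_zero]
  exact RatFunc.algebraMap_ne_zero (det_sysMatrix_X_ne_zero F)

/-- The matrix `[Gzx, Gzu]` for `F = [A, B]`; its columns are indexed by the states and inputs. -/
noncomputable def transfer {n m : ℕ} (F : Matrix (Fin n) (Fin n ⊕ Fin m) ℝ) :
    Matrix (Fin n ⊕ Fin m) (Fin n ⊕ Fin m) (RatFunc ℝ) :=
  (sysMatrix RatFunc.X (F.map RatFunc.C))⁻¹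

theorem isUnit_scalar_X_sub {n : ℕ} (A : Matrix (Fin n) (Fin n) ℝ) :
    IsUnit (Matrix.scalar (Fin n) RatFunc.X - A.map RatFunc.C) := by
  have h := isUnit_det_sysMatrix (Matrix.fromCols A (0 : Matrix (Fin n) (Fin 0) ℝ))
  rw [Matrix.fromCols_map, sysMatrix_fromCols, Matrix.det_fromBlocks_zero₂₁, Matrix.det_one,
    mul_one] at h
  exact (Matrix.isUnit_iff_isUnit_det _).2 h

theorem transfer_fromCols {n m : ℕ} (A : Matrix (Fin n) (Fin n) ℝ) (B : Matrix (Fin n) (Fin m) ℝ) :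
    transfer (Matrix.fromCols A B) = Matrix.fromCols (Gzx m A) (Gzu A B) := by
  have h1 := isUnit_scalar_X_sub A
  rw [transfer, Matrix.fromCols_map, sysMatrix_fromCols,
    Matrix.inv_fromBlocks_zero₂₁_of_isUnit_iff _ _ _ ⟨fun _ => isUnit_one, fun _ => h1⟩,
    inv_one, Matrix.mul_one, Matrix.mul_neg, neg_neg, ← Matrix.fromRows_fromCols_eq_fromBlocks,
    Gzx, Gzu, ratResolvent]
  ext i j
  rcases i with i | i <;> rcases j with j | j <;> rfl

theorem map_add_single {n m : ℕ} (F : Matrix (Fin n) (Fin n ⊕ Fin m) ℝ) (i : Fin n)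
    (j : Fin n ⊕ Fin m) (t : ℝ) :
    (F + Matrix.single i j t).map RatFunc.C =
      F.map RatFunc.C + Matrix.single i j (RatFunc.C t) := by
  ext a b
  simp [Matrix.single_apply, apply_ite RatFunc.C]

theorem mul_single_mul_apply {R κ : Type} [CommRing R] [Fintype κ] [DecidableEq κ]
    (M N : Matrix κ κ R) (i j : κ) (t : R) (a b : κ) :
    (M * Matrix.single i j t * N) a b = t * M a i * N j b := by
  rw [Matrix.mul_apply, Finset.sum_eq_single j]
  · simp [mul_comm]
  · intro k _ hk
    rw [Matrix.mul_single_apply_of_ne (hbj := hk), zero_mul]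
  · simp

theorem transfer_add_single {n m : ℕ} (F : Matrix (Fin n) (Fin n ⊕ Fin m) ℝ) (i : Fin n)
    (j : Fin n ⊕ Fin m) (t : ℝ) (a b : Fin n ⊕ Fin m) :
    transfer (F + Matrix.single i j t) a b = transfer F a b +
      RatFunc.C t * transfer F a (Sum.inl i) * transfer (F + Matrix.single i j t) j b := by
  set H := sysMatrix RatFunc.X (F.map RatFunc.C) with hH
  have h1 : transfer F * H = 1 := Matrix.nonsing_inv_mul _ (isUnit_det_sysMatrix F)
  have h2 : (H - Matrix.single (Sum.inl i) j (RatFunc.C t)) *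
      transfer (F + Matrix.single i j t) = 1 := by
    rw [hH, ← sysMatrix_add_single, ← map_add_single]
    exact Matrix.mul_nonsing_inv _ (isUnit_det_sysMatrix _)
  rw [← mul_single_mul_apply, ← Matrix.add_apply]
  refine congrFun (congrFun ?_ a) b
  calc transfer (F + Matrix.single i j t)
      = transfer F * H * transfer (F + Matrix.single i j t) := by rw [h1, Matrix.one_mul]
    _ = transfer F * ((H - Matrix.single (Sum.inl i) j (RatFunc.C t)) *
          transfer (F + Matrix.single i j t)) + transfer F *
          Matrix.single (Sum.inl i) j (RatFunc.C t) * transfer (F + Matrix.single i j t) := by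
        simp only [Matrix.sub_mul, Matrix.mul_sub, Matrix.mul_assoc, sub_add_cancel]
    _ = _ := by rw [h2, Matrix.mul_one]

theorem transfer_add_single' {n m : ℕ} (F : Matrix (Fin n) (Fin n ⊕ Fin m) ℝ) (i : Fin n)
    (j : Fin n ⊕ Fin m) (t : ℝ) (a b : Fin n ⊕ Fin m) :
    transfer (F + Matrix.single i j t) a b = transfer F a b +
      RatFunc.C t * transfer (F + Matrix.single i j t) a (Sum.inl i) * transfer F j b := by
  have h := transfer_add_single (F + Matrix.single i j t) i j (-t) a b
  have h0 : F + Matrix.single i j t + Matrix.single i j (-t) = F := by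
    rw [add_assoc, ← Matrix.single_add, add_neg_cancel, Matrix.single_zero, add_zero]
  rw [h0, map_neg] at h
  rw [h]
  ring

/-- The entry vanishes after the perturbation only if a polynomial of degree one in the size of the
perturbation does. -/
theorem transfer_eq_of_add_single_eq_zero {n m : ℕ} {F : Matrix (Fin n) (Fin n ⊕ Fin m) ℝ}
    {i : Fin n} {j : Fin n ⊕ Fin m} {t : ℝ} {a b : Fin n ⊕ Fin m}
    (h : transfer (F + Matrix.single i j t) a b = 0) :
    transfer F a b = RatFunc.C t * (transfer F a b * transfer F j (Sum.inl i) -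
      transfer F a (Sum.inl i) * transfer F j b) := by
  have h1 := transfer_add_single' F i j t a b
  have h2 := transfer_add_single' F i j t a (Sum.inl i)
  rw [h] at h1
  linear_combination (-RatFunc.C t * transfer F j b) * h2 +
    (RatFunc.C t * transfer F j (Sum.inl i) - 1) * h1

/-- A nonzero transfer from `b` to `a`, either direct or through the new connection from `j` to `i`,
stays nonzero for all but finitely many sizes of this connection. -/
theorem finite_transfer_add_single_eq_zero {n m : ℕ} (F : Matrix (Fin n) (Fin n ⊕ Fin m) ℝ)
    (i : Fin n) (j : Fin n ⊕ Fin m) (a b : Fin n ⊕ Fin m)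
    (h : transfer F a b ≠ 0 ∨ transfer F a (Sum.inl i) ≠ 0 ∧ transfer F j b ≠ 0) :
    {t : ℝ | transfer (F + Matrix.single i j t) a b = 0}.Finite := by
  apply Set.Subsingleton.finite
  intro t ht s hs
  have h1 := transfer_eq_of_add_single_eq_zero ht
  have h2 := transfer_eq_of_add_single_eq_zero hs
  by_contra hts
  have hC : (RatFunc.C t : RatFunc ℝ) - RatFunc.C s ≠ 0 := by
    rw [sub_ne_zero]
    exact fun h => hts (RatFunc.C.injective h)
  have h3 : transfer F a b * transfer F j (Sum.inl i) -
      transfer F a (Sum.inl i) * transfer F j b = 0 := by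
    apply (mul_eq_zero.1 _).resolve_left hC
    linear_combination h2 - h1
  rw [h3, mul_zero] at h1
  rw [h1, zero_mul, zero_sub, neg_eq_zero, mul_eq_zero] at h3
  tauto

theorem transfer_ne_zero_of_add_single {n m : ℕ} {F : Matrix (Fin n) (Fin n ⊕ Fin m) ℝ}
    {i : Fin n} {j : Fin n ⊕ Fin m} {t : ℝ} {b : Fin n ⊕ Fin m}
    (h : transfer (F + Matrix.single i j t) j b ≠ 0) : transfer F j b ≠ 0 := by
  intro h0
  rw [transfer_add_single', h0, mul_zero, add_zero] at h
  exact h rfl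

/-! ### Reachability and one-entry perturbations -/

/-- Reachability of the vertices `z` from the inputs in the auxiliary connection graph of
`F = [A, B]` in which the connections in `S` are present. -/
inductive Reach {n m : ℕ} (F : Matrix (Fin n) (Fin n ⊕ Fin m) ℝ)
    (S : Set (Fin n × (Fin n ⊕ Fin m))) : Fin n ⊕ Fin m → Prop
  | input (u : Fin m) (z : Fin n ⊕ Fin m) (h : transfer F z (Sum.inr u) ≠ 0) : Reach F S z
  | step (z : Fin n ⊕ Fin m) (i : Fin n) (z' : Fin n ⊕ Fin m) (hz : Reach F S z)
      (hS : (i, z) ∈ S) (h : transfer F z' (Sum.inl i) ≠ 0) : Reach F S z'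

/-- A connection that starts at `j` is not needed to reach `j`. -/
theorem Reach.of_insert {n m : ℕ} {F : Matrix (Fin n) (Fin n ⊕ Fin m) ℝ}
    {S : Set (Fin n × (Fin n ⊕ Fin m))} {i : Fin n} {j z : Fin n ⊕ Fin m}
    (h : Reach F (insert (i, j) S) z) : Reach F S z ∨ Reach F S j := by
  induction h with
  | input u z h => exact Or.inl (.input u z h)
  | step z i' z' hz hS h ih =>
    rcases ih with ih | ih
    · rcases hS with hS | hS
      · rw [Prod.mk.injEq] at hS
        exact Or.inr (hS.2 ▸ ih)
      · exact Or.inl (.step z i' z' ih hS h)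
    · exact Or.inr ih

/-- A connection may be replaced by an entry of `F`: for all but finitely many values of the entry
the reachable vertices stay reachable. -/
theorem finite_not_reach_add_single {n m : ℕ} (F : Matrix (Fin n) (Fin n ⊕ Fin m) ℝ)
    (S : Set (Fin n × (Fin n ⊕ Fin m))) (i : Fin n) (j : Fin n ⊕ Fin m) :
    {t : ℝ | ¬ ∀ z, Reach F (insert (i, j) S) z → Reach (F + Matrix.single i j t) S z}.Finite := by
  have hfin : (⋃ a : Fin n ⊕ Fin m, ⋃ b : Fin n ⊕ Fin m,
      {t : ℝ | (transfer F a b ≠ 0 ∨ transfer F a (Sum.inl i) ≠ 0 ∧ transfer F j b ≠ 0) ∧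
        transfer (F + Matrix.single i j t) a b = 0}).Finite := by
    refine Set.finite_iUnion fun a => Set.finite_iUnion fun b => ?_
    by_cases h : transfer F a b ≠ 0 ∨ transfer F a (Sum.inl i) ≠ 0 ∧ transfer F j b ≠ 0
    · exact (finite_transfer_add_single_eq_zero F i j a b h).subset fun t ht => ht.2
    · exact Set.finite_empty.subset fun t ht => h ht.1
  refine hfin.subset fun t ht => ?_
  by_contra hgood
  have good : ∀ a b, (transfer F a b ≠ 0 ∨ transfer F a (Sum.inl i) ≠ 0 ∧ transfer F j b ≠ 0) →
      transfer (F + Matrix.single i j t) a b ≠ 0 := fun a b h h0 =>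
    hgood (Set.mem_iUnion.2 ⟨a, Set.mem_iUnion.2 ⟨b, h, h0⟩⟩)
  apply ht
  intro z hz
  induction hz with
  | input u z h => exact .input u z (good _ _ (Or.inl h))
  | step z i' z' hz hS h ih =>
    rcases hS with hS | hS
    · obtain ⟨rfl, rfl⟩ := Prod.mk.inj hS
      -- the last edge into the tail of the removed connection is extended across the connection
      cases ih with
      | input u _ hu =>
        exact .input u z' (good _ _ (Or.inr ⟨h, transfer_ne_zero_of_add_single hu⟩))
      | step w k _ hw hkS hk =>
        exact .step w k z' hw hkS (good _ _ (Or.inr ⟨h, transfer_ne_zero_of_add_single hk⟩))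
    · exact .step z i' z' ih hS (good _ _ (Or.inl h))

/-- The matrices that vanish outside the set `S` of positions. -/
def supportedOn {n m : ℕ} (S : Set (Fin n × (Fin n ⊕ Fin m))) :
    Set (Matrix (Fin n) (Fin n ⊕ Fin m) ℝ) :=
  {Δ | ∀ i j, (i, j) ∉ S → Δ i j = 0}

theorem single_add_mem_supportedOn {n m : ℕ} {S : Set (Fin n × (Fin n ⊕ Fin m))} {i : Fin n}
    {j : Fin n ⊕ Fin m} (t : ℝ) {Δ : Matrix (Fin n) (Fin n ⊕ Fin m) ℝ} (h : Δ ∈ supportedOn S) :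
    Matrix.single i j t + Δ ∈ supportedOn (insert (i, j) S) := by
  intro a b hab
  rw [Set.mem_insert_iff, not_or] at hab
  rw [Matrix.add_apply, h a b hab.2, add_zero]
  apply Matrix.single_apply_of_ne
  rintro ⟨rfl, rfl⟩
  exact hab.1 rfl

theorem exists_single_add_of_mem_supportedOn {n m : ℕ} {S : Set (Fin n × (Fin n ⊕ Fin m))}
    {i : Fin n} {j : Fin n ⊕ Fin m} {Δ : Matrix (Fin n) (Fin n ⊕ Fin m) ℝ}
    (h : Δ ∈ supportedOn (insert (i, j) S)) :
    ∃ t, ∃ Δ' ∈ supportedOn S, Δ = Matrix.single i j t + Δ' := by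
  by_cases hij : (i, j) ∈ S
  · refine ⟨0, Δ, ?_, by simp⟩
    rwa [Set.insert_eq_of_mem hij] at h
  · refine ⟨Δ i j, Δ - Matrix.single i j (Δ i j), ?_, by simp⟩
    intro a b hab
    by_cases hk : (a, b) = (i, j)
    · obtain ⟨rfl, rfl⟩ := Prod.mk.inj hk
      simp
    · rw [Matrix.sub_apply, h a b (by simp [hk, hab]), Matrix.single_apply_of_ne, sub_zero]
      rintro ⟨rfl, rfl⟩
      exact hk rfl

/-- A reachable vertex receives a nonzero transfer from some input under a suitable perturbation. -/
theorem Reach.exists_transfer_ne_zero {n m : ℕ} (S : Finset (Fin n × (Fin n ⊕ Fin m)))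
    {F : Matrix (Fin n) (Fin n ⊕ Fin m) ℝ} {z : Fin n ⊕ Fin m} (h : Reach F S z) :
    ∃ Δ ∈ supportedOn (S : Set (Fin n × (Fin n ⊕ Fin m))), ∃ u : Fin m,
      transfer (F + Δ) z (Sum.inr u) ≠ 0 := by
  classical
  induction S using Finset.induction_on generalizing F with
  | empty =>
    cases h with
    | input u _ h => exact ⟨0, fun _ _ _ => rfl, u, by rwa [add_zero]⟩
    | step _ _ _ _ hS _ => exact absurd hS (by simp)
  | insert k S _ ih =>
    obtain ⟨i, j⟩ := k
    rw [Finset.coe_insert] at h ⊢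
    obtain ⟨t, ht⟩ := (finite_not_reach_add_single F S i j).exists_notMem
    rw [Set.mem_ofPred_eq, not_not] at ht
    obtain ⟨Δ, hΔ, u, hu⟩ := ih (ht z h)
    exact ⟨_, single_add_mem_supportedOn t hΔ, u, by rwa [← add_assoc]⟩

/-! ### Sufficiency -/

/-- If some input influences the `j`-th variable, then only finitely many `μ` can be uncontrollable
modes after a change of an entry in column `j`: a left eigenvector for `μ` is, up to a factor, row
`j` of the transfer matrix at `μ`, so that the transfer to `j` vanishes at `μ`. -/
theorem finite_not_hautus_add_single {n m : ℕ} {F : Matrix (Fin n) (Fin n ⊕ Fin m) ℝ} (i : Fin n)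
    {j : Fin n ⊕ Fin m} {u : Fin m} (h : transfer F j (Sum.inr u) ≠ 0) :
    {μ : ℂ | ∃ t : ℝ, ¬ Hautus (F + Matrix.single i j t) μ}.Finite := by
  set H := sysMatrix Polynomial.X (F.map (Polynomial.C : ℝ →+* Polynomial ℝ)) with hH
  have hadj : H.adjugate j (Sum.inr u) ≠ 0 := by
    intro h0
    apply h
    have hmap : ((H.map (algebraMap (Polynomial ℝ) (RatFunc ℝ))).adjugate) j (Sum.inr u) =
        algebraMap (Polynomial ℝ) (RatFunc ℝ) (H.adjugate j (Sum.inr u)) := by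
      rw [← RingHom.mapMatrix_apply, ← RingHom.map_adjugate]
      rfl
    rw [transfer, ← algebraMap_sysMatrix, Matrix.inv_def, Matrix.smul_apply, ← hH, hmap, h0,
      map_zero, smul_zero]
  have hp : (H.det * H.adjugate j (Sum.inr u)).map Complex.ofRealHom ≠ 0 := by
    rw [Polynomial.map_ne_zero_iff Complex.ofRealHom.injective]
    exact mul_ne_zero (det_sysMatrix_X_ne_zero F) hadj
  refine (Polynomial.finite_setOfPred_isRoot hp).subset ?_
  rintro μ ⟨t, ht⟩
  rw [Hautus] at ht
  push Not at ht
  obtain ⟨v, hv, hv0⟩ := ht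
  let e : Polynomial ℝ →+* ℂ := Polynomial.eval₂RingHom Complex.ofRealHom μ
  have hHe : H.map e = sysMatrix μ (F.map Complex.ofReal) := by
    rw [hH, sysMatrix_map, Matrix.map_map]
    congr 2
    · simp [e]
    · ext x
      simp [e]
  set c : ℂ := (t : ℂ) * v i with hc
  have h1 : Sum.elim v 0 ᵥ* H.map e = Pi.single j c := by
    have h2 : (F + Matrix.single i j t).map Complex.ofReal =
        F.map Complex.ofReal + Matrix.single i j (t : ℂ) := by
      ext a b
      simp [Matrix.single_apply, apply_ite Complex.ofReal]
    rw [h2, Matrix.vecMul_add] at hv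
    have h3 : v ᵥ* Matrix.single i j (t : ℂ) = Pi.single j c := by
      ext b
      by_cases hb : b = j
      · subst hb
        simp [Matrix.vecMul, dotProduct, Matrix.single_apply, hc, mul_comm]
      · simp [Matrix.vecMul, dotProduct, hb, Ne.symm hb]
    rw [h3] at hv
    rw [hHe, sysMatrix, Matrix.vecMul_sub, Matrix.vecMul_fromRows, Matrix.vecMul_zero, add_zero,
      sub_eq_iff_eq_add, add_comm, Sum.elim_comp_inl, hv]
    ext b
    rcases b with b | b <;> simp [Matrix.vecMul_diagonal, mul_comm]
  have h4 : e H.det • Sum.elim v 0 = Pi.single j c ᵥ* (H.map e).adjugate := by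
    rw [← h1, Matrix.vecMul_vecMul, Matrix.mul_adjugate, Matrix.vecMul_smul, Matrix.vecMul_one,
      RingHom.map_det, RingHom.mapMatrix_apply]
  have h5 : ∀ b, (Pi.single j c ᵥ* (H.map e).adjugate) b = c * e (H.adjugate j b) := by
    intro b
    rw [Matrix.single_vecMul, ← RingHom.mapMatrix_apply, ← RingHom.map_adjugate]
    rfl
  have h6 := congrFun h4 (Sum.inr u)
  rw [h5] at h6
  simp only [Pi.smul_apply, Sum.elim_inr, Pi.zero_apply, smul_zero] at h6
  rw [Set.mem_ofPred_eq, Polynomial.IsRoot, Polynomial.eval_map]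
  change e (H.det * H.adjugate j (Sum.inr u)) = 0
  rw [map_mul]
  rcases mul_eq_zero.1 h6.symm with hc0 | ha
  · rw [hc0, Pi.single_zero, Matrix.zero_vecMul] at h4
    have : e H.det = 0 := by
      by_contra hd
      apply hv0
      ext k
      simpa [hd] using congrFun h4 (Sum.inl k)
    rw [this, zero_mul]
  · rw [ha, mul_zero]

theorem hautus_iff_rank {n m : ℕ} (F : Matrix (Fin n) (Fin n ⊕ Fin m) ℝ) (μ : ℂ) :
    Hautus F μ ↔
      (Matrix.fromCols (Matrix.scalar (Fin n) μ) 0 - F.map Complex.ofReal).rank = n := by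
  rw [rank_eq_iff_vecMul_injective, Hautus]
  refine forall_congr' fun v => ?_
  rw [Matrix.vecMul_sub, sub_eq_zero, eq_comm, Matrix.vecMul_fromCols, Matrix.vecMul_zero]
  have h1 : v ᵥ* Matrix.scalar (Fin n) μ = μ • v := by
    ext i
    simp [Matrix.vecMul_diagonal, mul_comm]
  rw [h1]

theorem finite_not_hautus_of_hautus {n m : ℕ} (F N : Matrix (Fin n) (Fin n ⊕ Fin m) ℝ) (μ : ℂ)
    (h : Hautus F μ) : {t : ℝ | ¬ Hautus (F + t • N) μ}.Finite := by
  have h1 := finite_not_rank_add_smul _ (-N.map Complex.ofReal) ((hautus_iff_rank F μ).1 h)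
  refine h1.subset fun t ht hr => ht ((hautus_iff_rank _ μ).2 ?_)
  refine Eq.trans ?_ hr
  congr 1
  ext a b
  simp
  ring

/-- The free entries are fixed one at a time. All but finitely many values of an entry leave every
vertex reachable. As the variable that the entry multiplies is influenced by an input, the new value
can spoil only finitely many modes `μ`, and each of these for finitely many values only. -/
theorem exists_hautus_of_reach {n m : ℕ} (S : Finset (Fin n × (Fin n ⊕ Fin m)))
    (F : Matrix (Fin n) (Fin n ⊕ Fin m) ℝ)
    (hrank : ∀ μ : ℂ, ∃ Δ ∈ supportedOn (S : Set (Fin n × (Fin n ⊕ Fin m))), Hautus (F + Δ) μ)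
    (hreach : ∀ z, Reach F S z) :
    ∃ Δ ∈ supportedOn (S : Set (Fin n × (Fin n ⊕ Fin m))), ∀ μ : ℂ, Hautus (F + Δ) μ := by
  classical
  induction S using Finset.induction_on generalizing F with
  | empty =>
    refine ⟨0, fun _ _ _ => rfl, fun μ => ?_⟩
    obtain ⟨Δ, hΔ, h⟩ := hrank μ
    have : Δ = 0 := by
      ext a b
      exact hΔ a b (by simp)
    rwa [this] at h
  | insert k S _ ih =>
    obtain ⟨i, j⟩ := k
    rw [Finset.coe_insert] at hrank hreach ⊢
    have hj : Reach F S j := (hreach j).of_insert.elim id id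
    obtain ⟨Δ₀, hΔ₀, u, hu⟩ := hj.exists_transfer_ne_zero S
    have hmodes := finite_not_hautus_add_single i hu
    set modes := {μ : ℂ | ∃ t : ℝ, ¬ Hautus (F + Δ₀ + Matrix.single i j t) μ}
    have hbad : (⋃ μ ∈ modes, {t : ℝ | ∀ Δ ∈ supportedOn (S : Set (Fin n × (Fin n ⊕ Fin m))),
        ¬ Hautus (F + Matrix.single i j t + Δ) μ}).Finite := by
      refine hmodes.biUnion fun μ _ => ?_
      obtain ⟨Δ, hΔ, hμ⟩ := hrank μ
      obtain ⟨t₀, Δ', hΔ', rfl⟩ := exists_single_add_of_mem_supportedOn hΔ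
      refine ((finite_not_hautus_of_hautus _ (Matrix.single i j 1) μ hμ).image
        fun s => t₀ + s).subset ?_
      intro t ht
      refine ⟨t - t₀, ?_, by ring⟩
      have hsum : F + (Matrix.single i j t₀ + Δ') + (t - t₀) • Matrix.single i j 1 =
          F + Matrix.single i j t + Δ' := by
        rw [Matrix.smul_single, smul_eq_mul, mul_one, ← sub_add_cancel t t₀, Matrix.single_add,
          add_sub_cancel_right]
        abel
      rw [Set.mem_ofPred_eq, hsum]
      exact ht Δ' hΔ'
    obtain ⟨t, ht⟩ := (hbad.union (finite_not_reach_add_single F S i j)).exists_notMem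
    rw [Set.mem_union, not_or, Set.mem_ofPred_eq, not_not] at ht
    obtain ⟨Δ, hΔ, hH⟩ := ih (F + Matrix.single i j t) (fun μ => by
      by_cases hμ : μ ∈ modes
      · by_contra! hc
        exact ht.1 (Set.mem_biUnion hμ hc)
      · refine ⟨Δ₀, hΔ₀, ?_⟩
        by_contra hc
        refine hμ ⟨t, ?_⟩
        rwa [add_right_comm]) (fun z => ht.2 z (hreach z))
    exact ⟨_, single_add_mem_supportedOn t hΔ, fun μ => by rw [← add_assoc]; exact hH μ⟩

/-! ### Necessity of reachability -/

theorem algebraMap_charpoly {n : ℕ} (A : Matrix (Fin n) (Fin n) ℝ) :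
    algebraMap (Polynomial ℝ) (RatFunc ℝ) A.charpoly =
      (Matrix.scalar (Fin n) RatFunc.X - A.map RatFunc.C).det := by
  rw [Matrix.charpoly, RingHom.map_det]
  congr 1
  ext i j
  by_cases h : i = j <;> simp [Matrix.charmatrix, h]

theorem vecMulVec_map_ratFuncC {n : ℕ} (v w : Fin n → ℝ) :
    (Matrix.vecMulVec w v).map RatFunc.C =
      Matrix.vecMulVec (fun i => RatFunc.C (w i)) fun i => RatFunc.C (v i) := by
  ext i j
  simp [Matrix.vecMulVec_apply]

/-- If the rational function `vᵀ (λ I - A)⁻¹ w` is zero, then so is its leading coefficient `vᵀ w` at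
infinity: by the matrix determinant lemma `A - w vᵀ` and `A` have the same characteristic
polynomial, hence the same trace. -/
theorem dotProduct_eq_zero_of_resolvent {n : ℕ} (A : Matrix (Fin n) (Fin n) ℝ) (v w : Fin n → ℝ)
    (h : (fun i => RatFunc.C (v i)) ⬝ᵥ (ratResolvent A *ᵥ fun i => RatFunc.C (w i)) = 0) :
    v ⬝ᵥ w = 0 := by
  set N := Matrix.scalar (Fin n) RatFunc.X - A.map RatFunc.C with hN
  have hNR : N * ratResolvent A = 1 :=
    Matrix.mul_nonsing_inv _ ((Matrix.isUnit_iff_isUnit_det _).1 (isUnit_scalar_X_sub A))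
  have hchar : (A - Matrix.vecMulVec w v).charpoly = A.charpoly := by
    apply RatFunc.algebraMap_injective ℝ
    rw [algebraMap_charpoly, algebraMap_charpoly, ← hN]
    have h1 : Matrix.scalar (Fin n) RatFunc.X - (A - Matrix.vecMulVec w v).map RatFunc.C =
        N * (1 + Matrix.vecMulVec (ratResolvent A *ᵥ fun i => RatFunc.C (w i))
          fun i => RatFunc.C (v i)) := by
      rw [Matrix.mul_add, Matrix.mul_one, Matrix.mul_vecMulVec, Matrix.mulVec_mulVec, hNR,
        Matrix.one_mulVec, ← vecMulVec_map_ratFuncC, hN, Matrix.map_sub _ (map_sub _)]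
      abel
    rw [h1, Matrix.det_mul, Matrix.vecMulVec_eq Unit, Matrix.det_one_add_replicateCol_mul_replicateRow,
      h, add_zero, mul_one]
  have h2 := Matrix.trace_eq_neg_charpoly_nextCoeff (A - Matrix.vecMulVec w v)
  rw [hchar, ← Matrix.trace_eq_neg_charpoly_nextCoeff, Matrix.trace_sub, sub_eq_self,
    Matrix.trace_vecMulVec, dotProduct_comm] at h2
  exact h2

theorem transfer_inl {n m : ℕ} (A : Matrix (Fin n) (Fin n) ℝ) (B : Matrix (Fin n) (Fin m) ℝ)
    (k : Fin n) (b : Fin n ⊕ Fin m) :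
    transfer (Matrix.fromCols A B) (Sum.inl k) b =
      (ratResolvent A *ᵥ fun i => RatFunc.C ((Matrix.fromCols 1 B :
        Matrix (Fin n) (Fin n ⊕ Fin m) ℝ) i b)) k := by
  rw [transfer_fromCols]
  rcases b with b | b
  · have h1 : (fun i => RatFunc.C ((Matrix.fromCols 1 B :
        Matrix (Fin n) (Fin n ⊕ Fin m) ℝ) i (Sum.inl b))) = Pi.single b 1 := by
      ext i
      by_cases h : i = b <;> simp [h]
    rw [h1, Matrix.mulVec_single_one]
    rfl
  · rfl

theorem Reach.inr {n m : ℕ} (F : Matrix (Fin n) (Fin n ⊕ Fin m) ℝ)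
    (S : Set (Fin n × (Fin n ⊕ Fin m))) (u : Fin m) : Reach F S (Sum.inr u) := by
  refine .input u _ ?_
  obtain ⟨A, B, rfl⟩ : ∃ A B, F = Matrix.fromCols A B :=
    ⟨_, _, (Matrix.fromCols_toCols F).symm⟩
  rw [transfer_fromCols]
  simp [Gzu]

/-- If a vertex is unreachable, consider the row vectors `v` for which the rational functions
`vᵀ (λ I - A)⁻¹ e_i`, for the reachable states `i`, and `vᵀ (λ I - A)⁻¹ B` vanish. They form a
nonzero space that is invariant under `A + ΔA` and annihilated by `B + ΔB`. -/
theorem reach_of_hautus {n m : ℕ} {A ΔA : Matrix (Fin n) (Fin n) ℝ} {B ΔB : Matrix (Fin n) (Fin m) ℝ}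
    {S : Set (Fin n × (Fin n ⊕ Fin m))} (hΔ : Matrix.fromCols ΔA ΔB ∈ supportedOn S)
    (h : ∀ μ : ℂ, Hautus (Matrix.fromCols (A + ΔA) (B + ΔB)) μ) (z : Fin n ⊕ Fin m) :
    Reach (Matrix.fromCols A B) S z := by
  set F := Matrix.fromCols A B with hF
  by_contra hz
  -- the reachable sources: all inputs, and the states fed by reachable vertices
  let C : Set (Fin n ⊕ Fin m) := {b | ∀ i, b = Sum.inl i → ∃ z, Reach F S z ∧ (i, z) ∈ S}
  have hCr : ∀ u, Sum.inr u ∈ C := by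
    intro u i hi
    cases hi
  have hunreach : ∀ k, ¬ Reach F S k → ∀ b ∈ C, transfer F k b = 0 := by
    intro k hk b hb
    by_contra hne
    apply hk
    rcases b with i | u
    · obtain ⟨y, hy, hyS⟩ := hb i rfl
      exact .step y i k hy hyS hne
    · exact .input u k hne
  let V : Submodule ℝ (Fin n → ℝ) :=
    { carrier := {v | ∀ b ∈ C, ∑ k, RatFunc.C (v k) * transfer F (Sum.inl k) b = 0}
      add_mem' := by
        intro v w hv hw b hb
        simp only [Pi.add_apply, map_add, add_mul, Finset.sum_add_distrib, hv b hb, hw b hb,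
          add_zero]
      zero_mem' := by
        intro b _
        simp
      smul_mem' := by
        intro c v hv b hb
        simp only [Pi.smul_apply, smul_eq_mul, map_mul, mul_assoc, ← Finset.mul_sum, hv b hb,
          mul_zero] }
  have hsum : ∀ (v : Fin n → ℝ) (b : Fin n ⊕ Fin m),
      ∑ k, RatFunc.C (v k) * transfer F (Sum.inl k) b = (fun k => RatFunc.C (v k)) ⬝ᵥ
        (ratResolvent A *ᵥ fun i => RatFunc.C ((Matrix.fromCols 1 B :
          Matrix (Fin n) (Fin n ⊕ Fin m) ℝ) i b)) := by
    intro v b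
    exact Finset.sum_congr rfl fun k _ => by rw [hF, transfer_inl]
  have hlead : ∀ v ∈ V, ∀ b ∈ C, (v ᵥ* (Matrix.fromCols 1 B :
      Matrix (Fin n) (Fin n ⊕ Fin m) ℝ)) b = 0 := by
    intro v hv b hb
    apply dotProduct_eq_zero_of_resolvent A v fun i => (Matrix.fromCols 1 B :
      Matrix (Fin n) (Fin n ⊕ Fin m) ℝ) i b
    rw [← hsum]
    exact hv b hb
  have hV0 : ∀ v ∈ V, ∀ i, Sum.inl i ∈ C → v i = 0 := by
    intro v hv i hi
    have := hlead v hv _ hi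
    rwa [Matrix.vecMul_fromCols, Sum.elim_inl, Matrix.vecMul_one] at this
  have hVΔ : ∀ v ∈ V, ∀ y, Reach F S y → (v ᵥ* Matrix.fromCols ΔA ΔB) y = 0 := by
    intro v hv y hy
    change ∑ i, v i * Matrix.fromCols ΔA ΔB i y = 0
    refine Finset.sum_eq_zero fun i _ => ?_
    by_cases hS : (i, y) ∈ S
    · rw [hV0 v hv i (fun k hk => ⟨y, hy, by cases hk; exact hS⟩), zero_mul]
    · rw [hΔ i y hS, mul_zero]
  have hVA : ∀ v ∈ V, v ᵥ* A ∈ V := by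
    intro v hv b hb
    set w : Fin n → RatFunc ℝ := fun i => RatFunc.C ((Matrix.fromCols 1 B :
          Matrix (Fin n) (Fin n ⊕ Fin m) ℝ) i b) with hw
    have hv1 := hv b hb
    rw [hsum] at hv1 ⊢
    have h1 : (fun k => RatFunc.C ((v ᵥ* A) k)) =
        (fun k => RatFunc.C (v k)) ᵥ* A.map RatFunc.C := by
      ext k
      simp [Matrix.vecMul, dotProduct]
    have h2 : (Matrix.scalar (Fin n) RatFunc.X - A.map RatFunc.C) * ratResolvent A = 1 :=
      Matrix.mul_nonsing_inv _ ((Matrix.isUnit_iff_isUnit_det _).1 (isUnit_scalar_X_sub A))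
    have h3 : A.map RatFunc.C * ratResolvent A =
        (RatFunc.X : RatFunc ℝ) • ratResolvent A - 1 := by
      rw [← h2, Matrix.sub_mul, Matrix.scalar_apply, ← Matrix.smul_eq_diagonal_mul, sub_sub_cancel]
    have h4 : (fun k => RatFunc.C (v k)) ⬝ᵥ w = 0 := by
      have h5 : (fun k => RatFunc.C (v k)) ⬝ᵥ w = RatFunc.C ((v ᵥ* (Matrix.fromCols 1 B :
          Matrix (Fin n) (Fin n ⊕ Fin m) ℝ)) b) := by
        simp only [hw, Matrix.vecMul, dotProduct, map_sum, map_mul]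
      rw [h5, hlead v hv b hb, map_zero]
    rw [h1, ← Matrix.dotProduct_mulVec, Matrix.mulVec_mulVec, h3, Matrix.sub_mulVec,
      Matrix.smul_mulVec, Matrix.one_mulVec, dotProduct_sub, dotProduct_smul, hv1, h4, smul_zero,
      sub_zero]
  have hVΔA : ∀ v ∈ V, v ᵥ* ΔA ∈ V := by
    intro v hv b hb
    refine Finset.sum_eq_zero fun k _ => ?_
    by_cases hk : Reach F S (Sum.inl k)
    · have h1 := hVΔ v hv _ hk
      rw [Matrix.vecMul_fromCols, Sum.elim_inl] at h1
      rw [h1, map_zero, zero_mul]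
    · rw [hunreach _ hk b hb, mul_zero]
  have hVne : V ≠ ⊥ := by
    rw [Submodule.ne_bot_iff]
    rcases z with i | u
    · refine ⟨Pi.single i 1, fun b hb => ?_, by simp⟩
      refine Finset.sum_eq_zero fun k _ => ?_
      by_cases hk : k = i
      · rw [hk, hunreach _ hz b hb, mul_zero]
      · rw [Pi.single_eq_of_ne hk, map_zero, zero_mul]
    · exact absurd (Reach.inr F S u) hz
  obtain ⟨μ, hμ⟩ := exists_not_hautus_of_invariant (A + ΔA) (B + ΔB) V hVne
    (fun v hv => by
      rw [Matrix.vecMul_add]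
      exact V.add_mem (hVA v hv) (hVΔA v hv))
    (fun v hv => by
      ext u
      have h1 := hlead v hv _ (hCr u)
      have h2 := hVΔ v hv _ (Reach.inr F S u)
      rw [Matrix.vecMul_fromCols, Sum.elim_inr] at h1 h2
      rw [Matrix.vecMul_add, Pi.add_apply, h1, h2, add_zero, Pi.zero_apply])
  exact hμ (h μ)

/-! ### Reachability in the auxiliary connection graph -/

/-- The positions of the free entries of `[𝒜, ℬ]`. -/
def freeEntries {n m : ℕ} (𝒜 : Pattern (Fin n) (Fin n)) (ℬ : Pattern (Fin n) (Fin m)) :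
    Set (Fin n × (Fin n ⊕ Fin m)) :=
  {p | Matrix.fromCols 𝒜 ℬ p.1 p.2 ≠ Entry.zero}

theorem fromCols_mem_supportedOn_iff {n m : ℕ} (𝒜 : Pattern (Fin n) (Fin n))
    (ℬ : Pattern (Fin n) (Fin m)) (ΔA : Matrix (Fin n) (Fin n) ℝ) (ΔB : Matrix (Fin n) (Fin m) ℝ) :
    Matrix.fromCols ΔA ΔB ∈ supportedOn (freeEntries 𝒜 ℬ) ↔
      ΔA ∈ 𝒜.realizations ∧ ΔB ∈ ℬ.realizations := by
  constructor
  · intro h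
    exact ⟨fun i j hij => h i (Sum.inl j) fun h' => h' hij,
      fun i j hij => h i (Sum.inr j) fun h' => h' hij⟩
  · rintro ⟨hA, hB⟩ i (j | j) hij
    · exact hA i j (not_not.1 hij)
    · exact hB i j (not_not.1 hij)

theorem inputReachable_z_iff {n m : ℕ} (A : Matrix (Fin n) (Fin n) ℝ)
    (B : Matrix (Fin n) (Fin m) ℝ) (𝒜 : Pattern (Fin n) (Fin n)) (ℬ : Pattern (Fin n) (Fin m))
    (z : Fin n ⊕ Fin m) :
    InputReachable (auxGraph A B 𝒜 ℬ) (.z z) ↔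
      Reach (Matrix.fromCols A B) (freeEntries 𝒜 ℬ) z := by
  constructor
  · rintro ⟨u, hu⟩
    let P : Vertex n m → Prop := fun v => match v with
      | .z z => Reach (Matrix.fromCols A B) (freeEntries 𝒜 ℬ) z
      | .x i => ∃ z, Reach (Matrix.fromCols A B) (freeEntries 𝒜 ℬ) z ∧ (i, z) ∈ freeEntries 𝒜 ℬ
      | .u _ => True
    have key : ∀ v, Relation.ReflTransGen (auxGraph A B 𝒜 ℬ).Adj (.u u) v → P v := by
      intro v hv
      induction hv with
      | refl => trivial
      | tail _ hadj ih =>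
        cases hadj with
        | xz j i h =>
          obtain ⟨y, hy, hyS⟩ := ih
          exact .step y j i hy hyS (by rw [transfer_fromCols]; exact h)
        | uz j i h => exact Reach.input j i (by rw [transfer_fromCols]; exact h)
        | zx i j h => exact ⟨i, ih, h⟩
    exact key _ hu
  · intro h
    induction h with
    | input u z h =>
      rw [transfer_fromCols] at h
      exact ⟨u, .single (.uz u z h)⟩
    | step z i z' _ hS h ih =>
      rw [transfer_fromCols] at h
      obtain ⟨u, hu⟩ := ih
      exact ⟨u, (hu.tail (.zx z i hS)).tail (.xz i z' h)⟩

/-- All edges from some `x` to some `z` are reachable exactly if all vertices `z` are: a reachable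
tail makes the head reachable, and `z i` for a state `i` is the head of an edge because row `i` of
the invertible resolvent is nonzero. -/
theorem xzEdges_reachable_iff {n m : ℕ} (A : Matrix (Fin n) (Fin n) ℝ)
    (B : Matrix (Fin n) (Fin m) ℝ) (𝒜 : Pattern (Fin n) (Fin n)) (ℬ : Pattern (Fin n) (Fin m)) :
    (∀ (j : Fin n) (i : Fin n ⊕ Fin m), (auxGraph A B 𝒜 ℬ).Adj (.x j) (.z i) →
        XZEdgeReachable (auxGraph A B 𝒜 ℬ) j i) ↔
      ∀ i : Fin n ⊕ Fin m, InputReachable (auxGraph A B 𝒜 ℬ) (.z i) := by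
  constructor
  · rintro h (i | u)
    · obtain ⟨j, hj⟩ : ∃ j, ratResolvent A i j ≠ 0 := by
        by_contra! hc
        have h1 : ratResolvent A *
            (Matrix.scalar (Fin n) RatFunc.X - A.map RatFunc.C) = 1 :=
          Matrix.nonsing_inv_mul _ ((Matrix.isUnit_iff_isUnit_det _).1 (isUnit_scalar_X_sub A))
        have h2 := congrFun (congrFun h1 i) i
        rw [Matrix.mul_apply, Finset.sum_eq_zero fun k _ => by rw [hc k, zero_mul],
          Matrix.one_apply_eq] at h2
        exact zero_ne_one h2
      have hadj : (auxGraph A B 𝒜 ℬ).Adj (.x j) (.z (Sum.inl i)) := .xz j (Sum.inl i) hj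
      rcases h j _ hadj with ⟨u, hu⟩ | hz
      · exact ⟨u, hu.tail hadj⟩
      · exact hz
    · exact (inputReachable_z_iff A B 𝒜 ℬ _).2 (Reach.inr _ _ u)
  · intro h j i _
    exact Or.inr (h i)

/-! ### Matroid intersection and the rank of a perturbed matrix -/

/-- A form of the Cauchy–Binet formula: the sum runs over all maps, so that every set of `k` columns
is counted `k!` times. -/
theorem factorial_mul_det_mul {R ι κ : Type} [CommRing R] [Fintype ι] [DecidableEq ι] [Fintype κ]
    (W : Matrix ι κ R) (V : Matrix κ ι R) :
    ((Fintype.card ι).factorial : R) * (W * V).det =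
      ∑ f : ι → κ, (W.submatrix id f).det * (V.submatrix f id).det := by
  classical
  have hexp : (W * V).det = ∑ f : ι → κ, (∏ i, W i (f i)) * (V.submatrix f id).det := by
    have h1 : W * V = fun i => ∑ k, W i k • V k := by
      ext i j
      simp [Matrix.mul_apply]
    have h2 := (Matrix.detRowAlternating (n := ι) (R := R)).toMultilinearMap.map_sum
      fun i k => W i k • V k
    rw [h1]
    refine h2.trans (Finset.sum_congr rfl fun f _ => ?_)
    exact (Matrix.detRowAlternating (n := ι) (R := R)).toMultilinearMap.map_smul_univ
      (fun i => W i (f i)) fun i => V (f i)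
  have hperm : ∀ σ : Equiv.Perm ι, (W * V).det =
      ∑ f : ι → κ, (Equiv.Perm.sign σ * ∏ i, W i (f (σ i))) * (V.submatrix f id).det := by
    intro σ
    rw [hexp, ← (Equiv.arrowCongr σ (Equiv.refl κ)).symm.sum_comp]
    refine Finset.sum_congr rfl fun f _ => ?_
    have h3 := Matrix.det_permute σ (V.submatrix f id)
    rw [Matrix.submatrix_submatrix] at h3
    change (∏ i, W i (f (σ i))) * (V.submatrix (f ∘ σ) id).det = _
    rw [Function.comp_id] at h3
    rw [h3]
    ring
  have hsum : ∑ _σ : Equiv.Perm ι, (W * V).det = ((Fintype.card ι).factorial : R) * (W * V).det := by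
    rw [Finset.sum_const, Finset.card_univ, Fintype.card_perm, nsmul_eq_mul]
  rw [← hsum, Finset.sum_congr rfl fun σ _ => hperm σ, Finset.sum_comm]
  refine Finset.sum_congr rfl fun f _ => ?_
  rw [← Finset.sum_mul, ← Matrix.det_transpose (W.submatrix id f),
    Matrix.det_apply' (W.submatrix id f)ᵀ]
  rfl

theorem linearIndependent_of_det_submatrix_ne_zero {K κ : Type} [Field K] {n : ℕ}
    {V : Matrix κ (Fin n) K} {f : Fin n → κ} (h : (V.submatrix f id).det ≠ 0) :
    LinearIndependent K (V.row ∘ f) :=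
  Matrix.linearIndependent_rows_iff_isUnit.2
    ((Matrix.isUnit_iff_isUnit_det _).2 (isUnit_iff_ne_zero.2 h))

theorem exists_colsIndep_of_isUnit_mul {K κ : Type} [Field K] [CharZero K] [Fintype κ] {n : ℕ}
    (W : Matrix (Fin n) κ K) (V : Matrix κ (Fin n) K) (h : (W * V).det ≠ 0) :
    ∃ I : Finset κ, I.card = n ∧ ColsIndep W I ∧ ColsIndep Vᵀ I := by
  classical
  have h1 := factorial_mul_det_mul W V
  have h2 : ∃ f ∈ (Finset.univ : Finset (Fin n → κ)),
      (W.submatrix id f).det * (V.submatrix f id).det ≠ 0 := by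
    apply Finset.exists_ne_zero_of_sum_ne_zero
    rw [← h1]
    exact mul_ne_zero (Nat.cast_ne_zero.2 (Nat.factorial_ne_zero _)) h
  obtain ⟨f, -, hf⟩ := h2
  have hV := linearIndependent_of_det_submatrix_ne_zero (right_ne_zero_of_mul hf)
  have hW : LinearIndependent K (Wᵀ.row ∘ f) := by
    apply linearIndependent_of_det_submatrix_ne_zero
    rw [← Matrix.det_transpose]
    exact left_ne_zero_of_mul hf
  have hinj : Function.Injective f := hV.injective.of_comp
  refine ⟨Finset.univ.image f, ?_, ?_, ?_⟩
  · rw [Finset.card_image_of_injective _ hinj, Finset.card_univ, Fintype.card_fin]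
  · rw [colsIndep_iff, Finset.coe_image, Finset.coe_univ, Set.image_univ,
      linearIndepOn_range_iff hinj]
    exact hW
  · rw [colsIndep_iff, Finset.coe_image, Finset.coe_univ, Set.image_univ,
      linearIndepOn_range_iff hinj]
    exact hV

/-- The same for a real matrix `V` and a product that is not square but has full row rank: the
independence of rows of `V` over `ℂ`, after multiplication by a right inverse, descends to `ℝ`. -/
theorem exists_colsIndep_of_rank_mul {κ τ : Type} [Fintype κ] [Fintype τ] {n : ℕ}
    (W : Matrix (Fin n) κ ℂ) (V : Matrix κ τ ℝ) (h : (W * V.map Complex.ofReal).rank = n) :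
    ∃ I : Finset κ, I.card = n ∧ ColsIndep W I ∧ ColsIndep Vᵀ I := by
  classical
  obtain ⟨Y, hY⟩ := exists_right_inverse_of_rank_eq _ h
  rw [Matrix.mul_assoc] at hY
  obtain ⟨I, hI, hW, hV⟩ := exists_colsIndep_of_isUnit_mul W (V.map Complex.ofReal * Y)
    (by rw [hY, Matrix.det_one]; exact one_ne_zero)
  refine ⟨I, hI, hW, ?_⟩
  rw [colsIndep_iff] at hV ⊢
  let g : (τ → ℝ) →ₗ[ℝ] (Fin n → ℂ) :=
    { toFun := fun y => (fun j => (y j : ℂ)) ᵥ* Y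
      map_add' := by
        intro y z
        rw [← Matrix.add_vecMul]
        congr 1
        ext j
        simp
      map_smul' := by
        intro c y
        rw [RingHom.id_apply, ← Matrix.smul_vecMul]
        congr 1
        ext j
        simp }
  have h1 : LinearIndepOn ℝ (V.map Complex.ofReal * Y)ᵀ.col (I : Set κ) :=
    LinearIndependent.restrict_scalars (R := ℝ) (by
      intro a b hab
      simpa using hab) hV
  exact LinearIndependent.of_comp g h1

theorem ColsIndep.eq_zero_of_dotProduct {K κ : Type} [Field K] {n : ℕ} {W : Matrix (Fin n) κ K}
    {I : Finset κ} (hW : ColsIndep W I) (hI : I.card = n) (v : Fin n → K)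
    (hv : ∀ k ∈ I, v ⬝ᵥ W.col k = 0) : v = 0 := by
  have h1 : (W.submatrix id (Subtype.val : I → κ)).rank = n := hW.trans hI
  rw [rank_eq_iff_vecMul_injective] at h1
  apply h1
  ext k
  exact hv k k.2

/-- The `I`-parts of `W` and `V` have a product of full row rank. Weight one on `I` and a generic
nonzero weight elsewhere keeps it. -/
theorem exists_weights_rank {κ τ : Type} [Fintype κ] [DecidableEq κ] [Fintype τ] {n : ℕ}
    (W : Matrix (Fin n) κ ℂ) (V : Matrix κ τ ℝ) {I : Finset κ} (hI : I.card = n)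
    (hW : ColsIndep W I) (hV : ColsIndep Vᵀ I) :
    ∃ x : κ → ℝ, (∀ k, x k ≠ 0) ∧
      (W * Matrix.diagonal (fun k => (x k : ℂ)) * V.map Complex.ofReal).rank = n := by
  let e : κ → ℂ := fun k => if k ∈ I then 1 else 0
  let e' : κ → ℂ := fun k => if k ∈ I then 0 else 1
  have h0 : (W * Matrix.diagonal e * V.map Complex.ofReal).rank = n := by
    rw [rank_eq_iff_vecMul_injective]
    intro v hv
    apply hW.eq_zero_of_dotProduct hI
    rw [← Matrix.vecMul_vecMul, ← Matrix.vecMul_vecMul] at hv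
    -- a complex linear relation between real rows splits into real and imaginary parts
    have hrel : ∀ j, ∑ k ∈ I, (v ⬝ᵥ W.col k) * (V k j : ℂ) = 0 := by
      intro j
      have h1 := congrFun hv j
      rw [Matrix.vecMul, dotProduct] at h1
      rw [← Finset.sum_subset (Finset.subset_univ I)] at h1
      · refine Eq.trans (Finset.sum_congr rfl fun k hk => ?_) h1
        rw [Matrix.vecMul_diagonal]
        simp only [e, hk, if_true, mul_one]
        rfl
      · intro k _ hk
        rw [Matrix.vecMul_diagonal]
        simp [e, hk]
    rw [colsIndep_iff, linearIndepOn_finset_iff] at hV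
    intro k hk
    apply Complex.ext
    · refine hV (fun k => (v ⬝ᵥ W.col k).re) ?_ k hk
      ext j
      have h2 := congrArg Complex.re (hrel j)
      simpa using h2
    · refine hV (fun k => (v ⬝ᵥ W.col k).im) ?_ k hk
      ext j
      have h2 := congrArg Complex.im (hrel j)
      simpa using h2
  obtain ⟨t, ht⟩ := ((finite_not_rank_add_smul _
    (W * Matrix.diagonal e' * V.map Complex.ofReal) h0).union (Set.finite_singleton 0)).exists_notMem
  rw [Set.mem_union, not_or, Set.mem_singleton_iff, Set.mem_ofPred_eq, not_not] at ht
  refine ⟨fun k => if k ∈ I then 1 else t, ?_, ?_⟩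
  · intro k
    by_cases hk : k ∈ I
    · simp [hk]
    · simpa [hk] using ht.2
  · refine Eq.trans (congrArg Matrix.rank ?_) ht.1
    have h1 : Matrix.diagonal (fun k => ((if k ∈ I then 1 else t : ℝ) : ℂ)) =
        Matrix.diagonal e + algebraMap ℝ ℂ t • Matrix.diagonal e' := by
      rw [← Matrix.diagonal_smul, Matrix.diagonal_add]
      congr 1
      ext k
      by_cases hk : k ∈ I <;> simp [e, e', hk]
    rw [h1, Matrix.mul_add, Matrix.add_mul, Matrix.mul_smul, Matrix.smul_mul]

/-- A common independent set of size `n` exists exactly if some matrix with pattern `P` can be added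
to `Q` to get full row rank. The sum `Q + Δ` is the product of `[I, Q]` and `[Δ; I]`, so that the
Cauchy–Binet formula yields a common independent set. Conversely, take the transpose `[D; diag d]`
of a realization whose columns in this set are independent, with nonzero `d`. For suitable nonzero
weights `x` the product `[I, Q] diag(x) [D; diag d]` has full rank, and up to a scaling of its columns
it is of the form `Q + Δ`. -/
theorem intersectionCard_iff {κ : Type} [Fintype κ] [DecidableEq κ] {n : ℕ}
    (Q : Matrix (Fin n) κ ℂ) (P : Pattern (Fin n) κ) :
    IntersectionCard (colMatroid (Matrix.fromCols (1 : Matrix (Fin n) (Fin n) ℂ) Q))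
        (Pattern.colMatroid (Matrix.fromCols Pᵀ (Pattern.diag κ))) n ↔
      ∃ Δ ∈ P.realizations, (Q + Δ.map Complex.ofReal).rank = n := by
  constructor
  · rintro ⟨⟨I, hI₁, hI₂, hI⟩, -⟩
    rw [colMatroid_indep] at hI₁
    rw [Pattern.colMatroid_indep, Pattern.colsIndep_iff] at hI₂
    obtain ⟨M, hM, hMI⟩ := hI₂
    let N : Matrix κ (Fin n ⊕ κ) ℝ := Matrix.fromCols 0 1
    have hfin : (⋃ j : κ, {t : ℝ | M j (Sum.inr j) + t = 0}).Finite := by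
      refine Set.finite_iUnion fun j => (Set.finite_singleton (-M j (Sum.inr j))).subset ?_
      intro t ht
      exact eq_neg_of_add_eq_zero_right ht
    obtain ⟨s, hs⟩ := ((finite_not_colsIndep M N I hMI).union hfin).exists_notMem
    rw [Set.mem_union, not_or, Set.mem_ofPred_eq, not_not] at hs
    obtain ⟨hsI, hs0⟩ := hs
    set M' := M + s • N with hM'
    have hd : ∀ j, M' j (Sum.inr j) ≠ 0 := by
      intro j h0
      apply hs0
      refine Set.mem_iUnion.2 ⟨j, ?_⟩
      simpa [hM', N] using h0
    have hoff : ∀ i j, i ≠ j → M' i (Sum.inr j) = 0 := by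
      intro i j hij
      have := hM i (Sum.inr j) (by simp [Pattern.diag, hij])
      simp [hM', N, this, hij]
    have hD : ∀ i j, P i j = Entry.zero → M' j (Sum.inl i) = 0 := by
      intro i j hij
      have := hM j (Sum.inl i) hij
      simp [hM', N, this]
    obtain ⟨x, hx, hrank⟩ := exists_weights_rank _ M'ᵀ hI hI₁ hsI
    refine ⟨Matrix.of fun i j =>
      x (Sum.inl i) * M' j (Sum.inl i) / (x (Sum.inr j) * M' j (Sum.inr j)), ?_, ?_⟩
    · intro i j hij
      simp [hD i j hij]
    · rw [rank_eq_iff_vecMul_injective] at hrank ⊢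
      intro v hv
      apply hrank
      ext j
      have h1 := congrFun hv j
      have hne : ((x (Sum.inr j) * M' j (Sum.inr j) : ℝ) : ℂ) ≠ 0 :=
        Complex.ofReal_ne_zero.2 (mul_ne_zero (hx _) (hd j))
      have h2 : (v ᵥ* (Matrix.fromCols (1 : Matrix (Fin n) (Fin n) ℂ) Q *
          Matrix.diagonal (fun k => (x k : ℂ)) * M'ᵀ.map Complex.ofReal)) j =
          ((x (Sum.inr j) * M' j (Sum.inr j) : ℝ) : ℂ) * (v ᵥ* (Q + Matrix.map (Matrix.of fun i j =>
            x (Sum.inl i) * M' j (Sum.inl i) / (x (Sum.inr j) * M' j (Sum.inr j)))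
              Complex.ofReal)) j := by
        rw [← Matrix.vecMul_vecMul, ← Matrix.vecMul_vecMul, Matrix.vecMul_fromCols,
          Matrix.vecMul_one]
        conv_lhs => rw [Matrix.vecMul, dotProduct, Fintype.sum_sum_type]
        have h3 : ∀ k, k ≠ j → M' j (Sum.inr k) = 0 := fun k hk => hoff j k hk.symm
        rw [Finset.sum_eq_single (a := j) (s := (Finset.univ : Finset κ))]
        · simp only [Matrix.vecMul_diagonal, Sum.elim_inl, Sum.elim_inr, Matrix.map_apply,
            Matrix.transpose_apply]
          rw [Matrix.vecMul_add, Pi.add_apply, mul_add, add_comm]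
          congr 1
          · push_cast
            ring
          · simp only [Matrix.vecMul, dotProduct, Finset.mul_sum, Matrix.map_apply, Matrix.of_apply]
            refine Finset.sum_congr rfl fun i _ => ?_
            rw [Complex.ofReal_div]
            field_simp
            push_cast
            ring
        · intro k _ hk
          rw [Matrix.map_apply, Matrix.transpose_apply, h3 k hk, Complex.ofReal_zero, mul_zero]
        · simp
      rw [h2, h1, Pi.zero_apply, mul_zero]
  · rintro ⟨Δ, hΔ, hrank⟩
    refine ⟨?_, ?_⟩
    · have h1 : Matrix.fromCols (1 : Matrix (Fin n) (Fin n) ℂ) Q *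
          (Matrix.fromRows Δ (1 : Matrix κ κ ℝ)).map Complex.ofReal = Q + Δ.map Complex.ofReal := by
        rw [Matrix.fromRows_map, Matrix.fromCols_mul_fromRows, Matrix.one_mul,
          Matrix.map_one _ Complex.ofReal_zero Complex.ofReal_one, Matrix.mul_one, add_comm]
      rw [← h1] at hrank
      obtain ⟨I, hI, hW, hV⟩ := exists_colsIndep_of_rank_mul _ _ hrank
      refine ⟨I, (colMatroid_indep _ _).2 hW, (Pattern.colMatroid_indep _ _).2
        ((Pattern.colsIndep_iff _ _).2 ⟨_, ?_, hV⟩), hI⟩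
      rintro i (j | j) hij
      · exact hΔ j i hij
      · have : i ≠ j := by
          rintro rfl
          simp [Pattern.diag] at hij
        simp [this.symm]
    · rintro r ⟨I, hI, -, rfl⟩
      rw [colMatroid_indep] at hI
      rw [← hI]
      simpa using Matrix.rank_le_card_height
        ((Matrix.fromCols (1 : Matrix (Fin n) (Fin n) ℂ) Q).submatrix id (Subtype.val : I → _))

theorem maxRankPerturbedPencil_iff {n m : ℕ} (A : Matrix (Fin n) (Fin n) ℝ)
    (B : Matrix (Fin n) (Fin m) ℝ) (𝒜 : Pattern (Fin n) (Fin n)) (ℬ : Pattern (Fin n) (Fin m))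
    (μ : ℂ) :
    MaxRankPerturbedPencil A B 𝒜 ℬ μ n ↔ ∃ Δ ∈ supportedOn (freeEntries 𝒜 ℬ),
      Hautus (Matrix.fromCols A B + Δ) μ := by
  constructor
  · rintro ⟨⟨ΔA, hA, ΔB, hB, h⟩, -⟩
    refine ⟨_, (fromCols_mem_supportedOn_iff 𝒜 ℬ ΔA ΔB).2 ⟨hA, hB⟩, ?_⟩
    rw [rank_pencil_eq_iff] at h
    rwa [fromCols_add_fromCols]
  · rintro ⟨Δ, hΔ, h⟩
    obtain ⟨ΔA, ΔB, rfl⟩ : ∃ ΔA ΔB, Δ = Matrix.fromCols ΔA ΔB :=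
      ⟨_, _, (Matrix.fromCols_toCols Δ).symm⟩
    obtain ⟨hA, hB⟩ := (fromCols_mem_supportedOn_iff 𝒜 ℬ ΔA ΔB).1 hΔ
    rw [fromCols_add_fromCols, ← rank_pencil_eq_iff] at h
    refine ⟨⟨ΔA, hA, ΔB, hB, h⟩, ?_⟩
    rintro r ⟨ΔA', -, ΔB', -, rfl⟩
    simpa using (pencil (A + ΔA') (B + ΔB') μ).rank_le_card_height

theorem maxRankPerturbedPencil_iff_intersectionCard {n m : ℕ} (A : Matrix (Fin n) (Fin n) ℝ)
    (B : Matrix (Fin n) (Fin m) ℝ) (𝒜 : Pattern (Fin n) (Fin n)) (ℬ : Pattern (Fin n) (Fin m))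
    (μ : ℂ) :
    MaxRankPerturbedPencil A B 𝒜 ℬ μ n ↔
      IntersectionCard
        (colMatroid (Matrix.fromCols (1 : Matrix (Fin n) (Fin n) ℂ) (pencil A B μ)))
        (Pattern.colMatroid
          (Matrix.fromCols (Matrix.fromCols 𝒜 ℬ)ᵀ (Pattern.diag (Fin n ⊕ Fin m)))) n := by
  -- the state part of the perturbation enters the pencil with a minus sign
  have hpencil : ∀ (ΔA : Matrix (Fin n) (Fin n) ℝ) (ΔB : Matrix (Fin n) (Fin m) ℝ),
      pencil A B μ + (Matrix.fromCols (-ΔA) ΔB).map Complex.ofReal =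
        pencil (A + ΔA) (B + ΔB) μ := by
    intro ΔA ΔB
    ext i j
    rcases j with j | j
    · simp [pencil]
      ring
    · simp [pencil]
  rw [intersectionCard_iff]
  constructor
  · rintro ⟨⟨ΔA, hA, ΔB, hB, h⟩, -⟩
    refine ⟨Matrix.fromCols (-ΔA) ΔB, ?_, by rw [hpencil, h]⟩
    rintro i (j | j) hij
    · simpa using hA i j hij
    · exact hB i j hij
  · rintro ⟨Δ, hΔ, h⟩
    obtain ⟨ΔA, ΔB, rfl⟩ : ∃ ΔA ΔB, Δ = Matrix.fromCols (-ΔA) ΔB :=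
      ⟨-Δ.toCols₁, Δ.toCols₂, by rw [neg_neg, Matrix.fromCols_toCols]⟩
    rw [hpencil, rank_pencil_eq_iff, ← fromCols_add_fromCols] at h
    refine (maxRankPerturbedPencil_iff A B 𝒜 ℬ μ).2 ⟨_, ?_, h⟩
    refine (fromCols_mem_supportedOn_iff 𝒜 ℬ ΔA ΔB).2 ⟨fun i j hij => ?_, fun i j hij => ?_⟩
    · simpa using hΔ i (Sum.inl j) hij
    · exact hΔ i (Sum.inr j) hij

end ZeroNormControl

/-! ### The equivalence -/

theorem theorem1 (n m : ℕ) (A : Matrix (Fin n) (Fin n) ℝ) (B : Matrix (Fin n) (Fin m) ℝ)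
    (𝒜 : ZeroNormControl.Pattern (Fin n) (Fin n)) (ℬ : ZeroNormControl.Pattern (Fin n) (Fin m)) :
    List.TFAE [
      ZeroNormControl.StructurallyControllable A B 𝒜 ℬ,
      (∀ μ ∈ ZeroNormControl.eigenvalues A,
          ZeroNormControl.MaxRankPerturbedPencil A B 𝒜 ℬ μ n) ∧
        (∀ (j : Fin n) (i : Fin n ⊕ Fin m),
          (ZeroNormControl.auxGraph A B 𝒜 ℬ).Adj (.x j) (.z i) →
            ZeroNormControl.XZEdgeReachable (ZeroNormControl.auxGraph A B 𝒜 ℬ) j i),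
      (∀ μ ∈ ZeroNormControl.eigenvalues A,
          ZeroNormControl.IntersectionCard
            (ZeroNormControl.colMatroid
              (Matrix.fromCols (1 : Matrix (Fin n) (Fin n) ℂ) (ZeroNormControl.pencil A B μ)))
            (ZeroNormControl.Pattern.colMatroid
              (Matrix.fromCols (Matrix.fromCols 𝒜 ℬ)ᵀ
                (ZeroNormControl.Pattern.diag (Fin n ⊕ Fin m))))
            n) ∧
        (∀ i : Fin n ⊕ Fin m,
          ZeroNormControl.InputReachable (ZeroNormControl.auxGraph A B 𝒜 ℬ) (.z i))] := by
  open ZeroNormControl in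
  tfae_have 2 ↔ 3 :=
    and_congr (forall₂_congr fun μ _ => maxRankPerturbedPencil_iff_intersectionCard A B 𝒜 ℬ μ)
      (xzEdges_reachable_iff A B 𝒜 ℬ)
  tfae_have 1 → 2 := by
    rintro ⟨ΔA, hA, ΔB, hB, h⟩
    have hΔ := (fromCols_mem_supportedOn_iff 𝒜 ℬ ΔA ΔB).2 ⟨hA, hB⟩
    rw [controllable_iff_hautus] at h
    refine ⟨fun μ _ => (maxRankPerturbedPencil_iff A B 𝒜 ℬ μ).2 ⟨_, hΔ, ?_⟩, ?_⟩
    · rw [fromCols_add_fromCols]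
      exact h μ
    · rw [xzEdges_reachable_iff]
      exact fun z => (inputReachable_z_iff A B 𝒜 ℬ z).2 (reach_of_hautus hΔ h z)
  tfae_have 2 → 1 := by
    rintro ⟨hrank, hedge⟩
    rw [xzEdges_reachable_iff] at hedge
    have hfin := Set.toFinite (freeEntries 𝒜 ℬ)
    obtain ⟨Δ, hΔ, h⟩ := exists_hautus_of_reach hfin.toFinset (Matrix.fromCols A B)
      (fun μ => by
        rw [hfin.coe_toFinset]
        by_cases hμ : μ ∈ eigenvalues A
        · exact (maxRankPerturbedPencil_iff A B 𝒜 ℬ μ).1 (hrank μ hμ)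
        · refine ⟨0, fun _ _ _ => rfl, ?_⟩
          rw [add_zero, ← rank_pencil_eq_iff]
          exact rank_pencil_of_notMem_eigenvalues A B hμ)
      (fun z => by
        rw [hfin.coe_toFinset]
        exact (inputReachable_z_iff A B 𝒜 ℬ z).1 (hedge z))
    rw [hfin.coe_toFinset] at hΔ
    obtain ⟨ΔA, ΔB, rfl⟩ : ∃ ΔA ΔB, Δ = Matrix.fromCols ΔA ΔB :=
      ⟨_, _, (Matrix.fromCols_toCols Δ).symm⟩
    obtain ⟨hA, hB⟩ := (fromCols_mem_supportedOn_iff 𝒜 ℬ ΔA ΔB).1 hΔ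
    rw [fromCols_add_fromCols] at h
    exact ⟨ΔA, hA, ΔB, hB, (controllable_iff_hautus _ _).2 h⟩
  tfae_finish
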